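/- **Setting.** Let $q_0$ be a probability distribution on $\mathbb{R}^d$ with second moment $\mathbb{E}_{y\sim q_0}\|y\|^2=m_2^2<\infty$, $m_2\ge 0$. For $t>0$ let $\sigma_t=\sqrt{1-e^{-2t}}$, let $q_t$ be the distribution of $x=e^{-t}y+z$ with $y\sim q_0$ and $z\sim\mathcal N(0,\sigma_t^2I_d)$ independent, and let $s_t=\nabla\log q_t$ be its score (the gradient of the logarithm of the density of $q_t$). For a probability distribution $p$ on $\mathbb{R}^d$, $\delta>0$ and $f,g:\mathbb{R}^d\to\mathbb{R}^d$ let $$D_p^{\delta}(f,g)=\inf\{r\ge 0:\ \Pr_{x\sim p}[\|f(x)-g(x)\|>r]\le\delta\},$$ so that $D_p^\delta(f,g)\le r$ if and only if $\Pr_{x\sim p}[\|f(x)-g(x)\|>r]\le\delta$. Let $\phi_\theta:\mathbb{R}^d\to\mathbb{R}^d$ be the fully connected ReLU network with arbitrary hidden widths, with $D\ge1$ weight matrices (its depth; ReLU after every layer except the last), with or without bias vectors, where $\theta\in\mathbb{R}^P$ collects all $P$ parameters. Given $m$ i.i.d. samples $y_1,\dots,y_m\sim q_0$ and independent $z_1,\dots,z_m\sim\mathcal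 N(0,\sigma_t^2I_d)$, put $x_i=e^{-t}y_i+z_i$. An *empirical minimizer* over $\|\theta\|_\infty\le\Theta$ is any $\widehat\theta$ with $\|\widehat\theta\|_\infty\le\Theta$ that minimizes $$\frac1m\sum_{i=1}^m\Big\|\phi_\theta(x_i)-\frac{-z_i}{\sigma_t^2}\Big\|^2$$ over all $\theta$ with $\|\theta\|_\infty\le\Theta$. **Lemma.** There are universal constants $C,K>0$ and $k\in\mathbb{N}$ such that the following holds for all $d$, $q_0$, $t>0$ and network architectures as above, all $\Theta>1$, $0<\varepsilon\le1$ and $\delta_{\text{score}},\delta_{\mathcal D}\in(0,1)$. Suppose there is some $\theta^*$ with $\|\theta^*\|_\infty\le\Theta$ and $$\mathbb{E}_{x\sim q_t}\big[\|\phi_{\theta^*}(x)-s_t(x)\|^2\big]\le\frac{\delta_{\text{score}}\cdot\delta_{\mathcal D}\cdot\varepsilon^2}{C\,\sigma_t^2}.$$ Let $$A=\frac{(d+\log\frac1{\delta_{\mathcal D}})\cdot P D}{\varepsilon^2\,\delta_{\text{score}}}\cdot\log\Big(\frac{2\max(m_2,1)\,\Theta}{\delta_{\mathcal D}}\Big).$$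 If $m>K\cdot A\cdot\log^k(2+A)$ (that is, $m>\widetilde O(A)$), then with probability at least $1-\delta_{\mathcal D}$ every empirical minimizer $\widehat\theta$ over $\|\theta\|_\infty\le\Theta$ satisfies $$D^{\delta_{\text{score}}}_{q_t}(\phi_{\widehat\theta},s_t)\le\varepsilon/\sigma_t .$$ -/

import Mathlib

open MeasureTheory ProbabilityTheory
open scoped ENNReal Gradient

namespace ScoreLearning

/-- Euclidean space `ℝᵈ` with the `ℓ²` norm. -/
abbrev Vec (d : ℕ) : Type := EuclideanSpace ℝ (Fin d)

/-! ### Fully connected ReLU networks -/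

/-- Positions of the parameters of one fully connected layer `ℝᵃ → ℝᵇ`: the entries `(i, j)` of the
weight matrix and, if `bias = true`, also the bias entries `(i, none)`. -/
def LayerIdx : (bias : Bool) → (a b : ℕ) → Type
  | false, a, b => Fin b × Fin a
  | true, a, b => Fin b × Option (Fin a)

instance LayerIdx.instFintype : (bias : Bool) → (a b : ℕ) → Fintype (LayerIdx bias a b)
  | false, a, b => inferInstanceAs (Fintype (Fin b × Fin a))
  | true, a, b => inferInstanceAs (Fintype (Fin b × Option (Fin a)))

/-- The map of one layer, before the activation: `x ↦ W x`, or `x ↦ W x + c` with biases. -/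
noncomputable def layer : (bias : Bool) → (a b : ℕ) → (LayerIdx bias a b → ℝ) → Vec a → Vec b
  | false, _, _, W, x => WithLp.toLp 2 fun i => ∑ j, W (i, j) * x j
  | true, _, _, W, x => WithLp.toLp 2 fun i => (∑ j, W (i, some j) * x j) + W (i, none)

/-- The coordinatewise ReLU activation. -/
noncomputable def relu {a : ℕ} (x : Vec a) : Vec a := WithLp.toLp 2 fun i => max (x i) 0

/-- Positions of all parameters of the network with input dimension `a`, output dimension `b` and
hidden layers of the listed widths. -/
def ParamIdx (bias : Bool) (b : ℕ) : (hidden : List ℕ) → (a : ℕ) → Type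
  | [], a => LayerIdx bias a b
  | h :: hidden, a => LayerIdx bias a h ⊕ ParamIdx bias b hidden h

instance ParamIdx.instFintype (bias : Bool) (b : ℕ) :
    (hidden : List ℕ) → (a : ℕ) → Fintype (ParamIdx bias b hidden a)
  | [], a => LayerIdx.instFintype bias a b
  | h :: hidden, a =>
    @instFintypeSum _ _ (LayerIdx.instFintype bias a h) (ParamIdx.instFintype bias b hidden h)

/-- The network function `φ_θ`: layers alternating with ReLU, no activation after the last layer.
The parameter vector `θ` is a real vector indexed by `ParamIdx`, so `‖θ‖` is `‖θ‖_∞`. -/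
noncomputable def network (bias : Bool) (b : ℕ) :
    (hidden : List ℕ) → (a : ℕ) → (ParamIdx bias b hidden a → ℝ) → Vec a → Vec b
  | [], a, θ, x => layer bias a b θ x
  | h :: hidden, a, θ, x =>
    network bias b hidden h (fun k => θ (Sum.inr k)) (relu (layer bias a h (fun k => θ (Sum.inl k)) x))

/-- The number of parameters. -/
def numParams (bias : Bool) (b : ℕ) (hidden : List ℕ) (a : ℕ) : ℕ :=
  Fintype.card (ParamIdx bias b hidden a)

/-- The depth: the number of weight matrices. -/
def depth (hidden : List ℕ) : ℕ := hidden.length + 1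

/-! ### The smoothed distribution and its score -/

/-- The noise level `σ_t = √(1 - e^{-2t})`. -/
noncomputable def sigma (t : ℝ) : ℝ := Real.sqrt (1 - Real.exp (-2 * t))

/-- The Gaussian distribution `N(0, σ² I_d)`. -/
noncomputable def gaussianNoise (d : ℕ) (σ : ℝ) : Measure (Vec d) :=
  (stdGaussian (Vec d)).map fun z => σ • z

/-- The noised point `x = e^{-t} y + z`. -/
noncomputable def noised {d : ℕ} (t : ℝ) (y z : Vec d) : Vec d := Real.exp (-t) • y + z

/-- The joint distribution of `(y, z)`, with `y ~ q₀` and `z ~ N(0, σ_t² I_d)` independent. -/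
noncomputable def sampleLaw {d : ℕ} (q₀ : Measure (Vec d)) (t : ℝ) : Measure (Vec d × Vec d) :=
  q₀.prod (gaussianNoise d (sigma t))

/-- The smoothed distribution `q_t`: the distribution of `e^{-t} y + z`. -/
noncomputable def smoothed {d : ℕ} (q₀ : Measure (Vec d)) (t : ℝ) : Measure (Vec d) :=
  (sampleLaw q₀ t).map fun p => noised t p.1 p.2

/-- The (smooth, positive) Lebesgue density of `q_t`: the `q₀`-average over `y` of the densities of
`N(e^{-t} y, σ_t² I_d)`. -/
noncomputable def smoothedDensity {d : ℕ} (q₀ : Measure (Vec d)) (t : ℝ) (x : Vec d) : ℝ :=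
  ∫ y, ((Real.sqrt (2 * Real.pi * sigma t ^ 2)) ^ d)⁻¹ *
    Real.exp (-‖x - Real.exp (-t) • y‖ ^ 2 / (2 * sigma t ^ 2)) ∂q₀

/-- The score `s_t = ∇ log q_t`. -/
noncomputable def score {d : ℕ} (q₀ : Measure (Vec d)) (t : ℝ) (x : Vec d) : Vec d :=
  ∇ (fun x' => Real.log (smoothedDensity q₀ t x')) x

/-! ### The quantile error -/

/-- The quantile error `D^δ_p(f, g)`: the least `r` such that `‖f x - g x‖ > r` has
`p`-probability at most `δ`. -/
noncomputable def quantileError {d : ℕ} (p : Measure (Vec d)) (δ : ℝ) (f g : Vec d → Vec d) : ℝ≥0∞ :=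
  sInf {r | p {x | r < ‖f x - g x‖ₑ} ≤ ENNReal.ofReal δ}

theorem quantileError_le_iff {d : ℕ} (p : Measure (Vec d)) (δ : ℝ) (f g : Vec d → Vec d)
    (r : ℝ≥0∞) :
    quantileError p δ f g ≤ r ↔ p {x | r < ‖f x - g x‖ₑ} ≤ ENNReal.ofReal δ := by
  constructor
  · intro h
    rcases eq_or_ne r ⊤ with rfl | hr
    · simp
    obtain ⟨u, hu, hlt, hlim⟩ := exists_seq_strictAnti_tendsto' (lt_top_iff_ne_top.2 hr)
    have hset : {x | r < ‖f x - g x‖ₑ} = ⋃ n, {x | u n < ‖f x - g x‖ₑ} := by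
      ext x
      simp only [Set.mem_ofPred_eq, Set.mem_iUnion]
      exact ⟨fun hx => (hlim.eventually_lt_const hx).exists,
        fun ⟨n, hn⟩ => (hlt n).1.trans hn⟩
    have hmono : Monotone fun n => {x | u n < ‖f x - g x‖ₑ} :=
      fun a b hab x hx => lt_of_le_of_lt (hu.antitone hab) hx
    rw [hset, hmono.measure_iUnion]
    refine iSup_le fun n => ?_
    obtain ⟨r', hr', hr'n⟩ := sInf_lt_iff.1 (lt_of_le_of_lt h (hlt n).1)
    exact (measure_mono fun x hx => lt_trans hr'n hx).trans hr'
  · exact fun h => sInf_le h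

/-! ### Empirical score matching -/

/-- The empirical score matching loss `l(f) = (1/m) ∑ᵢ ‖f(xᵢ) - (-zᵢ/σ_t²)‖²`, where
`ω i = (yᵢ, zᵢ)` and `xᵢ = e^{-t} yᵢ + zᵢ`. -/
noncomputable def empiricalLoss {d m : ℕ} (t : ℝ) (ω : Fin m → Vec d × Vec d)
    (f : Vec d → Vec d) : ℝ :=
  (1 / (m : ℝ)) * ∑ i, ‖f (noised t (ω i).1 (ω i).2) - (-((sigma t ^ 2)⁻¹ • (ω i).2))‖ ^ 2

/-- `θ` minimizes the empirical loss of `φ_θ` over all parameter vectors with `‖θ‖_∞ ≤ Θ`. -/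
def IsEmpiricalMinimizer {d m : ℕ} (bias : Bool) (hidden : List ℕ) (t Θ : ℝ)
    (ω : Fin m → Vec d × Vec d) (θ : ParamIdx bias d hidden d → ℝ) : Prop :=
  ‖θ‖ ≤ Θ ∧ ∀ θ' : ParamIdx bias d hidden d → ℝ, ‖θ'‖ ≤ Θ →
    empiricalLoss t ω (network bias d hidden d θ) ≤ empiricalLoss t ω (network bias d hidden d θ')

/-- The leading term of the sample complexity. -/
noncomputable def leadingTerm (d P D : ℕ) (m₂ Θ ε δscore δD : ℝ) : ℝ :=
  ((d : ℝ) + Real.log (1 / δD)) * (P * D) / (ε ^ 2 * δscore) *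
    Real.log (2 * (max m₂ 1 * Θ) / δD)

end ScoreLearning

/-!
Write `u = -z / σ_t²` for the regression target, `s` for the score and `ξ = u - s(x)` for the
noise. By Tweedie's formula (`score_eq_integral_posterior`), `ξ` is centred given the noised point
`x`, so the loss of `f` exceeds that of `s` by `∑ ‖g‖² - 2 ⟪g, ξ⟫`, where `g = f - s`.

The noise is unbounded, and truncating it would destroy the centring. Instead the sample is
restricted by a condition on `x` alone: `goodSet` consists of the `x` whose posterior exponential
moment of `‖z‖² / (4 σ_t²)` is at most `exp B`. Since the unconditional moment is at most `exp d`,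
all `m` points are good with high probability once `B = d + log (10 m / δ)`. Given a good `x` the
noise is both centred and sub-Gaussian with variance proxy of order `B / σ_t²`
(`lintegral_exp_inner_noise_le`). For a multiplier `l` of order `σ_t² / B` the cross term then costs
only half of the quadratic one:
`E[exp (-l (‖g‖² - 2 ⟪g, ξ⟫)) | x] ≤ exp (-l ‖g‖² / 2)`.

If `f` is far from the score, that is `‖g‖ > ε / (2 σ_t)` with probability at least `δ_score / 2`,
this moment is at most `1 - c δ_score ε² / B` on average (`lintegral_exp_neg_excessLoss_le`), and
Chernoff's bound makes a small excess loss exponentially unlikely in `m δ_score ε² / B`. In the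
other direction the excess loss of `φ_{θ*}` is small, by Markov's inequality for `∑ ‖g‖²` and the
same exponential moment for the cross term.

A union bound over a grid of parameters finishes the proof (`measure_pi_exists_bad_le`). The network
is Lipschitz in its parameters with constant of order `(P Θ + 1) ^ D`
(`norm_network_sub_le`), so the logarithm of the size of the grid is of order `P D` up to
logarithmic factors (`grid_size_le`). A minimizer far from the score would have a grid point nearby
that is far from the score as well and whose excess loss is small
(`sum_excessLoss_le_of_close`). The remaining inequality for `m` is `sample_size_le`.
-/

namespace ScoreLearning

/-! ### The Gaussian density and the law of the noised sample -/

/-- The Lebesgue density of `N(0, σ² I_d)`. -/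
noncomputable def gaussKernel (d : ℕ) (σ : ℝ) (v : Vec d) : ℝ :=
  ((Real.sqrt (2 * Real.pi * σ ^ 2)) ^ d)⁻¹ * Real.exp (-‖v‖ ^ 2 / (2 * σ ^ 2))

lemma continuous_gaussKernel (d : ℕ) (σ : ℝ) : Continuous (gaussKernel d σ) := by
  unfold gaussKernel
  fun_prop

lemma gaussKernel_pos (d : ℕ) {σ : ℝ} (hσ : 0 < σ) (v : Vec d) : 0 < gaussKernel d σ v := by
  unfold gaussKernel
  positivity

lemma gaussKernel_le (d : ℕ) {σ : ℝ} (hσ : 0 < σ) (v : Vec d) :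
    gaussKernel d σ v ≤ ((Real.sqrt (2 * Real.pi * σ ^ 2)) ^ d)⁻¹ := by
  unfold gaussKernel
  refine mul_le_of_le_one_right (by positivity) (Real.exp_le_one_iff.2 ?_)
  exact div_nonpos_of_nonpos_of_nonneg (by simp) (by positivity)

lemma integrable_exp_neg_mul_sq_norm (d : ℕ) {b : ℝ} (hb : 0 < b) :
    Integrable (fun v : Vec d => Real.exp (-b * ‖v‖ ^ 2)) := by
  have h := GaussianFourier.integrable_cexp_neg_mul_sq_norm_add (V := Vec d)
    (b := (b : ℂ)) (by simpa using hb) 0 0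
  refine (h.norm).congr (Filter.Eventually.of_forall fun v => ?_)
  simp [Complex.norm_exp, ← Complex.ofReal_pow]

lemma integrable_gaussKernel (d : ℕ) {σ : ℝ} (hσ : 0 < σ) : Integrable (gaussKernel d σ) := by
  have h := integrable_exp_neg_mul_sq_norm d (b := 1 / (2 * σ ^ 2)) (by positivity)
  refine (h.const_mul (((Real.sqrt (2 * Real.pi * σ ^ 2)) ^ d)⁻¹)).congr
    (Filter.Eventually.of_forall fun v => ?_)
  simp only [gaussKernel]
  congr 2
  ring

lemma sqrt_pow_eq_rpow {a : ℝ} (ha : 0 ≤ a) (d : ℕ) : (Real.sqrt a) ^ d = a ^ ((d : ℝ) / 2) := by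
  rw [Real.sqrt_eq_rpow, ← Real.rpow_natCast, ← Real.rpow_mul ha]
  congr 1
  ring

lemma charFun_withDensity_gaussKernel (d : ℕ) {σ : ℝ} (hσ : 0 < σ) (t : Vec d) :
    charFun (volume.withDensity fun v : Vec d => ENNReal.ofReal (gaussKernel d σ v)) t
      = Complex.exp (-(σ ^ 2 * ‖t‖ ^ 2) / 2) := by
  have hb : 0 < ((1 / (2 * σ ^ 2) : ℝ) : ℂ).re := by
    rw [Complex.ofReal_re]; positivity
  have key := GaussianFourier.integral_cexp_neg_mul_sq_norm_add (V := Vec d) hb Complex.I t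
  rw [charFun_apply, integral_withDensity_eq_integral_toReal_smul
    (continuous_gaussKernel d σ).measurable.ennreal_ofReal
    (Filter.Eventually.of_forall fun _ => ENNReal.ofReal_lt_top)]
  have h1 : ∀ v : Vec d, (ENNReal.ofReal (gaussKernel d σ v)).toReal •
      Complex.exp ((inner ℝ v t : ℝ) * Complex.I) =
      (((Real.sqrt (2 * Real.pi * σ ^ 2)) ^ d)⁻¹ : ℝ) *
        Complex.exp (-((1 / (2 * σ ^ 2) : ℝ) : ℂ) * ‖v‖ ^ 2 + Complex.I * (inner ℝ t v : ℝ)) := by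
    intro v
    rw [ENNReal.toReal_ofReal (gaussKernel_pos d hσ v).le, gaussKernel, Complex.real_smul,
      Complex.ofReal_mul, Complex.ofReal_exp, mul_assoc, ← Complex.exp_add, real_inner_comm]
    congr 2
    push_cast
    ring
  simp_rw [h1]
  rw [integral_const_mul, key]
  have h2 : ((Real.pi : ℂ) / ((1 / (2 * σ ^ 2) : ℝ) : ℂ)) ^ ((Module.finrank ℝ (Vec d) : ℂ) / 2)
      = (((Real.sqrt (2 * Real.pi * σ ^ 2)) ^ d : ℝ) : ℂ) := by
    rw [sqrt_pow_eq_rpow (by positivity), Complex.ofReal_cpow (by positivity)]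
    simp only [finrank_euclideanSpace, Fintype.card_fin]
    congr 1
    · push_cast
      field_simp
    · push_cast; rfl
  rw [h2, ← mul_assoc, ← Complex.ofReal_mul, inv_mul_cancel₀ (by positivity)]
  simp only [Complex.ofReal_one, one_mul, Complex.I_sq]
  congr 1
  push_cast
  have : (σ : ℂ) ≠ 0 := by exact_mod_cast hσ.ne'
  field_simp
  ring

lemma gaussianNoise_eq_withDensity (d : ℕ) {σ : ℝ} (hσ : 0 < σ) :
    gaussianNoise d σ = volume.withDensity fun v => ENNReal.ofReal (gaussKernel d σ v) := by
  have : IsFiniteMeasure (volume.withDensity fun v : Vec d => ENNReal.ofReal (gaussKernel d σ v)) :=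
    isFiniteMeasure_withDensity_ofReal (integrable_gaussKernel d hσ).2
  have : IsProbabilityMeasure (gaussianNoise d σ) :=
    Measure.isProbabilityMeasure_map (by fun_prop)
  apply Measure.ext_of_charFun
  ext t
  rw [charFun_withDensity_gaussKernel d hσ, gaussianNoise, charFun_map_smul, charFun_stdGaussian,
    norm_smul]
  congr 1
  push_cast
  rw [mul_pow, ← Complex.ofReal_pow, Real.norm_eq_abs, sq_abs]
  push_cast
  ring

instance (d : ℕ) (σ : ℝ) : IsProbabilityMeasure (gaussianNoise d σ) :=
  Measure.isProbabilityMeasure_map (by fun_prop)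

instance {d : ℕ} (q₀ : Measure (Vec d)) [IsProbabilityMeasure q₀] (t : ℝ) :
    IsProbabilityMeasure (sampleLaw q₀ t) := by
  unfold sampleLaw; infer_instance

lemma measurable_noised {d : ℕ} (t : ℝ) :
    Measurable fun p : Vec d × Vec d => noised t p.1 p.2 := by
  unfold noised; fun_prop

instance {d : ℕ} (q₀ : Measure (Vec d)) [IsProbabilityMeasure q₀] (t : ℝ) :
    IsProbabilityMeasure (smoothed q₀ t) :=
  Measure.isProbabilityMeasure_map (measurable_noised t).aemeasurable

lemma sigma_sq {t : ℝ} (ht : 0 < t) : sigma t ^ 2 = 1 - Real.exp (-2 * t) := by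
  rw [sigma, Real.sq_sqrt]
  have : Real.exp (-2 * t) ≤ 1 := Real.exp_le_one_iff.2 (by linarith)
  linarith

lemma sigma_pos {t : ℝ} (ht : 0 < t) : 0 < sigma t := by
  rw [sigma, Real.sqrt_pos]
  have : Real.exp (-2 * t) < 1 := Real.exp_lt_one_iff.2 (by linarith)
  linarith

lemma sigma_le_one {t : ℝ} (ht : 0 < t) : sigma t ≤ 1 := by
  have := sigma_sq ht
  nlinarith [Real.exp_pos (-2 * t), sigma_pos ht]

/-- Tonelli in the coordinates `(x, y)`, where `x = e^{-t} y + z` is the noised point: given `x`,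
the point `y` has the unnormalised posterior density `gaussKernel (x - e^{-t} y)` with respect to
`q₀`. -/
lemma lintegral_sampleLaw {d : ℕ} (q₀ : Measure (Vec d)) [IsProbabilityMeasure q₀] {t : ℝ}
    (ht : 0 < t) {F : Vec d → Vec d → ℝ≥0∞} (hF : Measurable (Function.uncurry F)) :
    ∫⁻ p, F (noised t p.1 p.2) p.2 ∂(sampleLaw q₀ t) =
      ∫⁻ x, ∫⁻ y, ENNReal.ofReal (gaussKernel d (sigma t) (x - Real.exp (-t) • y)) *
        F x (x - Real.exp (-t) • y) ∂q₀ := by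
  have hK : Measurable (gaussKernel d (sigma t)) := (continuous_gaussKernel d _).measurable
  have hm : Measurable fun p : Vec d × Vec d => F (noised t p.1 p.2) p.2 :=
    hF.comp ((measurable_noised t).prodMk measurable_snd)
  rw [sampleLaw, lintegral_prod _ hm.aemeasurable]
  have hmxy : Measurable fun p : Vec d × Vec d =>
      ENNReal.ofReal (gaussKernel d (sigma t) (p.1 - Real.exp (-t) • p.2)) *
        F p.1 (p.1 - Real.exp (-t) • p.2) := by
    refine Measurable.mul (hK.comp (by fun_prop)).ennreal_ofReal ?_
    exact hF.comp (g := Function.uncurry F)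
      (f := fun p : Vec d × Vec d => (p.1, p.1 - Real.exp (-t) • p.2)) (by fun_prop)
  rw [lintegral_lintegral_swap (μ := volume) (ν := q₀) hmxy.aemeasurable]
  refine lintegral_congr fun y => ?_
  have hmy : Measurable fun z : Vec d => F (noised t y z) z := hm.comp measurable_prodMk_left
  change ∫⁻ z, F (noised t y z) z ∂(gaussianNoise d (sigma t)) = _
  rw [gaussianNoise_eq_withDensity d (sigma_pos ht),
    lintegral_withDensity_eq_lintegral_mul _ hK.ennreal_ofReal hmy]
  rw [← lintegral_sub_right_eq_self _ (Real.exp (-t) • y)]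
  refine lintegral_congr fun x => ?_
  simp [noised]

/-! ### Sub-Gaussian bounds from exponential square moments -/

lemma exp_le_self_add_exp_sq (x : ℝ) : Real.exp x ≤ x + Real.exp (x ^ 2) := by
  have h2 := Real.add_one_le_exp (x ^ 2)
  rcases le_total x (-1) with h | h
  · have : Real.exp x ≤ 1 := Real.exp_le_one_iff.2 (by linarith)
    nlinarith
  rcases le_total x 1 with h' | h'
  · have := Real.abs_exp_sub_one_sub_id_le (abs_le.2 ⟨h, h'⟩)
    linarith [(abs_le.1 this).2]
  · have : Real.exp x ≤ Real.exp (x ^ 2) := Real.exp_le_exp.2 (by nlinarith)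
    linarith

section SubGaussian

variable {Ω : Type*} [MeasurableSpace Ω] {ν : Measure Ω} [IsProbabilityMeasure ν]

/-- Jensen's inequality for `w ↦ w ^ θ`, with `w = exp (a v ^ 2)`. -/
lemma integral_exp_mul_sq_le {v : Ω → ℝ} (hv : AEMeasurable v ν) {a B θ : ℝ} (ha : 0 < a)
    (hθ0 : 0 ≤ θ) (hθ1 : θ ≤ 1) (hint : Integrable (fun ω => Real.exp (a * v ω ^ 2)) ν)
    (hB : ∫ ω, Real.exp (a * v ω ^ 2) ∂ν ≤ Real.exp B) :
    Integrable (fun ω => Real.exp (θ * a * v ω ^ 2)) ν ∧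
      ∫ ω, Real.exp (θ * a * v ω ^ 2) ∂ν ≤ Real.exp (θ * B) := by
  have hI : Integrable (fun ω => Real.exp (θ * a * v ω ^ 2)) ν := by
    refine hint.mono' (by fun_prop) (Filter.Eventually.of_forall fun ω => ?_)
    rw [Real.norm_eq_abs, Real.abs_exp, Real.exp_le_exp]
    nlinarith [mul_nonneg ha.le (sq_nonneg (v ω))]
  refine ⟨hI, ?_⟩
  -- convexity of `exp` on the segment from `0` to `a v ^ 2 - B`
  have hpt : ∀ ω, Real.exp (θ * a * v ω ^ 2) ≤
      Real.exp (θ * B) * (θ * (Real.exp (-B) * Real.exp (a * v ω ^ 2)) + (1 - θ)) := by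
    intro ω
    have hc := convexOn_exp.2 (Set.mem_univ (a * v ω ^ 2 - B)) (Set.mem_univ (0 : ℝ)) hθ0
      (sub_nonneg.2 hθ1) (by ring)
    simp only [smul_eq_mul, mul_zero, add_zero, Real.exp_zero, mul_one] at hc
    rw [← Real.exp_add, show -B + a * v ω ^ 2 = a * v ω ^ 2 - B by ring]
    calc Real.exp (θ * a * v ω ^ 2) = Real.exp (θ * B) * Real.exp (θ * (a * v ω ^ 2 - B)) := by
          rw [← Real.exp_add]; congr 1; ring
      _ ≤ _ := by gcongr
  have hI2 : Integrable (fun ω => θ * (Real.exp (-B) * Real.exp (a * v ω ^ 2))) ν :=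
    (hint.const_mul _).const_mul _
  calc _ ≤ ∫ ω, Real.exp (θ * B) *
        (θ * (Real.exp (-B) * Real.exp (a * v ω ^ 2)) + (1 - θ)) ∂ν :=
        integral_mono hI ((hI2.add (integrable_const _)).const_mul _) hpt
    _ = Real.exp (θ * B) *
        (θ * (Real.exp (-B) * ∫ ω, Real.exp (a * v ω ^ 2) ∂ν) + (1 - θ)) := by
        rw [integral_const_mul, integral_add hI2 (integrable_const _), integral_const_mul,
          integral_const_mul]
        simp
    _ ≤ Real.exp (θ * B) * (θ * (Real.exp (-B) * Real.exp B) + (1 - θ)) := by gcongr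
    _ = Real.exp (θ * B) := by
        rw [← Real.exp_add]; simp

/-- A centred variable with a bounded exponential square moment is sub-Gaussian. -/
lemma integral_exp_mul_le_of_exp_sq {v : Ω → ℝ} (hv : Integrable v ν) (hv0 : ∫ ω, v ω ∂ν = 0)
    {a B : ℝ} (ha : 0 < a) (hB1 : 1 ≤ B)
    (hint : Integrable (fun ω => Real.exp (a * v ω ^ 2)) ν)
    (hB : ∫ ω, Real.exp (a * v ω ^ 2) ∂ν ≤ Real.exp B) (s : ℝ) :
    Integrable (fun ω => Real.exp (s * v ω)) ν ∧
      ∫ ω, Real.exp (s * v ω) ∂ν ≤ Real.exp (B * s ^ 2 / a) := by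
  have hvm := hv.aemeasurable
  have hθ : s ^ 2 / a * a = s ^ 2 := by field_simp
  rcases le_or_gt (s ^ 2 / a) 1 with h | h
  · obtain ⟨hI, hle⟩ := integral_exp_mul_sq_le hvm ha (by positivity) h hint hB
    rw [hθ] at hI hle
    have hpt : ∀ ω, Real.exp (s * v ω) ≤ s * v ω + Real.exp (s ^ 2 * v ω ^ 2) := fun ω => by
      simpa [mul_pow] using exp_le_self_add_exp_sq (s * v ω)
    have hIs := (hv.const_mul s).add hI
    have hIe : Integrable (fun ω => Real.exp (s * v ω)) ν :=
      hIs.mono' (by fun_prop) (Filter.Eventually.of_forall fun ω => by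
        rw [Real.norm_eq_abs, Real.abs_exp]; exact hpt ω)
    refine ⟨hIe, (integral_mono hIe hIs hpt).trans ?_⟩
    simp only [Pi.add_apply]
    rw [integral_add (hv.const_mul s) hI, integral_const_mul, hv0, mul_zero, zero_add]
    exact hle.trans_eq (by congr 1; ring)
  · obtain ⟨hI, hle⟩ := integral_exp_mul_sq_le hvm ha (θ := 1 / 2) (by norm_num) (by norm_num)
      hint hB
    have hpt : ∀ ω, Real.exp (s * v ω) ≤
        Real.exp (s ^ 2 / a / 2) * Real.exp (1 / 2 * a * v ω ^ 2) := fun ω => by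
      rw [← Real.exp_add, Real.exp_le_exp]
      have h1 : s ^ 2 / a / 2 + 1 / 2 * a * v ω ^ 2 - s * v ω = (s - a * v ω) ^ 2 / (2 * a) := by
        field_simp; ring
      have : 0 ≤ (s - a * v ω) ^ 2 / (2 * a) := by positivity
      linarith
    have hIs := hI.const_mul (Real.exp (s ^ 2 / a / 2))
    have hIe : Integrable (fun ω => Real.exp (s * v ω)) ν :=
      hIs.mono' (by fun_prop) (Filter.Eventually.of_forall fun ω => by
        rw [Real.norm_eq_abs, Real.abs_exp]; exact hpt ω)
    refine ⟨hIe, (integral_mono hIe hIs hpt).trans ?_⟩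
    rw [integral_const_mul]
    calc _ ≤ Real.exp (s ^ 2 / a / 2) * Real.exp (1 / 2 * B) := by gcongr
      _ ≤ _ := by
        rw [← Real.exp_add, Real.exp_le_exp, mul_div_assoc]
        nlinarith

variable {E : Type*} [NormedAddCommGroup E] [InnerProductSpace ℝ E] [CompleteSpace E]

/-- Jensen's inequality for `exp`: an exponential square moment bounds the mean. -/
lemma mul_sq_norm_integral_le {X : Ω → E} (hX : Integrable X ν) {b B : ℝ} (hb : 0 < b)
    (hint : Integrable (fun ω => Real.exp (b * ‖X ω‖ ^ 2)) ν)
    (hB : ∫ ω, Real.exp (b * ‖X ω‖ ^ 2) ∂ν ≤ Real.exp B) :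
    b * ‖∫ ω, X ω ∂ν‖ ^ 2 ≤ B := by
  set c := ∫ ω, X ω ∂ν with hc
  -- `b (2 ⟪c, X⟫ - ‖c‖²) ≤ b ‖X‖²`, and `exp` lies above its tangent at `B`
  have hpt : ∀ ω, Real.exp B * (1 + (b * (2 * inner ℝ c (X ω) - ‖c‖ ^ 2) - B)) ≤
      Real.exp (b * ‖X ω‖ ^ 2) := by
    intro ω
    have h1 : 2 * inner ℝ c (X ω) - ‖c‖ ^ 2 ≤ ‖X ω‖ ^ 2 := by
      have := norm_sub_sq_real c (X ω)
      nlinarith [sq_nonneg ‖c - X ω‖]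
    have h2 := Real.add_one_le_exp (b * ‖X ω‖ ^ 2 - B)
    have h3 : Real.exp (b * ‖X ω‖ ^ 2) = Real.exp B * Real.exp (b * ‖X ω‖ ^ 2 - B) := by
      rw [← Real.exp_add]; congr 1; ring
    rw [h3]
    have := mul_le_mul_of_nonneg_left h1 hb.le
    gcongr
    linarith
  have hIi : Integrable (fun ω => 2 * inner ℝ c (X ω)) ν := (hX.const_inner c).const_mul 2
  have hI1 : Integrable (fun ω => b * (2 * inner ℝ c (X ω) - ‖c‖ ^ 2)) ν :=
    (hIi.sub (integrable_const _)).const_mul _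
  have hI2 : Integrable (fun ω => b * (2 * inner ℝ c (X ω) - ‖c‖ ^ 2) - B) ν :=
    hI1.sub (integrable_const _)
  have hI3 := (((integrable_const (μ := ν) (1 : ℝ)).add hI2).const_mul (Real.exp B))
  have h := (integral_mono hI3 hint hpt).trans hB
  simp only [Pi.add_apply] at h
  rw [integral_const_mul, integral_add (integrable_const _) hI2,
    integral_sub hI1 (integrable_const _), integral_const_mul,
    integral_sub hIi (integrable_const _), integral_const_mul, integral_inner hX] at h
  rw [← hc] at h
  simp only [integral_const, probReal_univ, one_smul, real_inner_self_eq_norm_sq] at h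
  have h4 : 1 + (b * (2 * ‖c‖ ^ 2 - ‖c‖ ^ 2) - B) ≤ 1 :=
    le_of_mul_le_mul_left (by simpa using h) (Real.exp_pos B)
  linarith

/-- A vector with a bounded exponential square moment is sub-Gaussian around its mean. -/
lemma integral_exp_inner_le {X : Ω → E} (hX : Integrable X ν) {b B : ℝ} (hb : 0 < b)
    (hB1 : 1 ≤ B) (hint : Integrable (fun ω => Real.exp (b * ‖X ω‖ ^ 2)) ν)
    (hB : ∫ ω, Real.exp (b * ‖X ω‖ ^ 2) ∂ν ≤ Real.exp B) (h : E) :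
    Integrable (fun ω => Real.exp (inner ℝ h (X ω - ∫ ω, X ω ∂ν))) ν ∧
      ∫ ω, Real.exp (inner ℝ h (X ω - ∫ ω, X ω ∂ν)) ∂ν ≤ Real.exp (4 * B * ‖h‖ ^ 2 / b) := by
  rcases eq_or_ne h 0 with rfl | hh
  · simp
  have hmean := mul_sq_norm_integral_le hX hb hint hB
  set c := ∫ ω, X ω ∂ν with hc
  have hn : 0 < ‖h‖ := norm_pos_iff.2 hh
  -- the direction of `h`; the scalar estimate is applied with `s = ‖h‖`
  set v : Ω → ℝ := fun ω => inner ℝ (‖h‖⁻¹ • h) (X ω - c) with hv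
  have hXc : Integrable (fun ω => X ω - c) ν := hX.sub (integrable_const _)
  have hvI : Integrable v ν := hXc.const_inner _
  have hv0 : ∫ ω, v ω ∂ν = 0 := by
    rw [hv, integral_inner hXc, integral_sub hX (integrable_const _)]
    simp [hc]
  have hsq : ∀ ω, Real.exp (b / 2 * v ω ^ 2) ≤ Real.exp B * Real.exp (b * ‖X ω‖ ^ 2) := by
    intro ω
    rw [← Real.exp_add, Real.exp_le_exp]
    have h1 : |v ω| ≤ ‖X ω - c‖ := by
      refine (abs_real_inner_le_norm _ _).trans_eq ?_
      rw [norm_smul, norm_inv, norm_norm, inv_mul_cancel₀ hn.ne', one_mul]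
    have h2 : ‖X ω - c‖ ≤ ‖X ω‖ + ‖c‖ := norm_sub_le _ _
    have h3 : v ω ^ 2 ≤ (‖X ω‖ + ‖c‖) ^ 2 := by
      rw [← sq_abs]; gcongr; exact h1.trans h2
    have h4 : v ω ^ 2 ≤ 2 * ‖X ω‖ ^ 2 + 2 * ‖c‖ ^ 2 := by nlinarith [sq_nonneg (‖X ω‖ - ‖c‖)]
    nlinarith
  have hI2 := hint.const_mul (Real.exp B)
  have hvint : Integrable (fun ω => Real.exp (b / 2 * v ω ^ 2)) ν :=
    hI2.mono' (by have := hvI.aemeasurable; fun_prop) (Filter.Eventually.of_forall fun ω => by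
      rw [Real.norm_eq_abs, Real.abs_exp]; exact hsq ω)
  have hvB : ∫ ω, Real.exp (b / 2 * v ω ^ 2) ∂ν ≤ Real.exp (2 * B) := by
    refine (integral_mono hvint hI2 hsq).trans ?_
    rw [integral_const_mul, two_mul, Real.exp_add]
    gcongr
  have key := integral_exp_mul_le_of_exp_sq hvI hv0 (by positivity) (by linarith) hvint hvB ‖h‖
  have hvh : ∀ ω, ‖h‖ * v ω = inner ℝ h (X ω - c) := fun ω => by
    simp only [hv, real_inner_smul_left]
    rw [← mul_assoc, mul_inv_cancel₀ hn.ne', one_mul]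
  simp_rw [hvh] at key
  refine ⟨key.1, key.2.trans_eq ?_⟩
  congr 1
  field_simp
  ring

end SubGaussian

/-! ### The posterior distribution and Tweedie's formula -/

section Posterior

variable {d : ℕ} (q₀ : Measure (Vec d)) {t : ℝ}

lemma smoothedDensity_eq (x : Vec d) : smoothedDensity q₀ t x =
    ∫ y, gaussKernel d (sigma t) (x - Real.exp (-t) • y) ∂q₀ := rfl

lemma measurable_ofReal_gaussKernel_comp (t : ℝ) (x : Vec d) :
    Measurable fun y => ENNReal.ofReal (gaussKernel d (sigma t) (x - Real.exp (-t) • y)) :=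
  ((continuous_gaussKernel d _).comp (by fun_prop)).measurable.ennreal_ofReal

variable (t) in
/-- The posterior distribution of `y` given the noised point `x = e^{-t} y + z`. -/
noncomputable def posterior (x : Vec d) : Measure (Vec d) :=
  (ENNReal.ofReal (smoothedDensity q₀ t x))⁻¹ •
    q₀.withDensity fun y => ENNReal.ofReal (gaussKernel d (sigma t) (x - Real.exp (-t) • y))

lemma lintegral_posterior (x : Vec d) (f : Vec d → ℝ≥0∞) (hf : Measurable f) :
    ∫⁻ y, f y ∂(posterior q₀ t x) = (ENNReal.ofReal (smoothedDensity q₀ t x))⁻¹ *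
      ∫⁻ y, ENNReal.ofReal (gaussKernel d (sigma t) (x - Real.exp (-t) • y)) * f y ∂q₀ := by
  rw [posterior, lintegral_smul_measure, smul_eq_mul,
    lintegral_withDensity_eq_lintegral_mul _ (measurable_ofReal_gaussKernel_comp t x) hf]
  rfl

lemma measurable_score : Measurable (score q₀ t) := by
  unfold score gradient
  exact (LinearIsometryEquiv.continuous _).measurable.comp (measurable_fderiv ℝ _)

variable [IsProbabilityMeasure q₀]

lemma integrable_gaussKernel_comp (ht : 0 < t) (x : Vec d) :
    Integrable (fun y => gaussKernel d (sigma t) (x - Real.exp (-t) • y)) q₀ := by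
  refine Integrable.of_bound (Continuous.aestronglyMeasurable ?_)
    (((Real.sqrt (2 * Real.pi * sigma t ^ 2)) ^ d)⁻¹) (Filter.Eventually.of_forall fun y => ?_)
  · exact (continuous_gaussKernel d _).comp (by fun_prop)
  · rw [Real.norm_eq_abs, abs_of_pos (gaussKernel_pos d (sigma_pos ht) _)]
    exact gaussKernel_le d (sigma_pos ht) _

lemma smoothedDensity_pos (ht : 0 < t) (x : Vec d) : 0 < smoothedDensity q₀ t x := by
  rw [smoothedDensity_eq, integral_pos_iff_support_of_nonneg
    (fun y => (gaussKernel_pos d (sigma_pos ht) _).le) (integrable_gaussKernel_comp q₀ ht x)]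
  have : Function.support (fun y => gaussKernel d (sigma t) (x - Real.exp (-t) • y)) = Set.univ :=
    Set.eq_univ_of_forall fun y => (gaussKernel_pos d (sigma_pos ht) _).ne'
  rw [this]
  simp

lemma ofReal_smoothedDensity (ht : 0 < t) (x : Vec d) : ENNReal.ofReal (smoothedDensity q₀ t x) =
    ∫⁻ y, ENNReal.ofReal (gaussKernel d (sigma t) (x - Real.exp (-t) • y)) ∂q₀ := by
  rw [smoothedDensity_eq, ofReal_integral_eq_lintegral_ofReal (integrable_gaussKernel_comp q₀ ht x)]
  exact Filter.Eventually.of_forall fun y => (gaussKernel_pos d (sigma_pos ht) _).le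

lemma isProbabilityMeasure_posterior (ht : 0 < t) (x : Vec d) :
    IsProbabilityMeasure (posterior q₀ t x) := by
  constructor
  rw [← lintegral_one, lintegral_posterior q₀ x _ measurable_const]
  simp only [mul_one]
  rw [← ofReal_smoothedDensity q₀ ht]
  exact ENNReal.inv_mul_cancel (by simpa using smoothedDensity_pos q₀ ht x) ENNReal.ofReal_ne_top

/-- Exponential moments of the noise below the critical order are finite under the posterior. -/
lemma integrable_exp_sq_posterior (ht : 0 < t) (x : Vec d) :
    Integrable (fun y => Real.exp (‖x - Real.exp (-t) • y‖ ^ 2 / (4 * sigma t ^ 2)))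
      (posterior q₀ t x) := by
  have hσ := sigma_pos ht
  refine ⟨Continuous.aestronglyMeasurable (by fun_prop), ?_⟩
  rw [hasFiniteIntegral_iff_ofReal (Filter.Eventually.of_forall fun _ => (Real.exp_pos _).le),
    lintegral_posterior q₀ x _ (by fun_prop)]
  refine ENNReal.mul_lt_top (by simpa using smoothedDensity_pos q₀ ht x) ?_
  refine (lintegral_mono (g := fun _ => ENNReal.ofReal
    ((Real.sqrt (2 * Real.pi * sigma t ^ 2)) ^ d)⁻¹) fun y => ?_).trans_lt (by simp)
  simp only
  rw [← ENNReal.ofReal_mul (gaussKernel_pos d hσ _).le]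
  refine ENNReal.ofReal_le_ofReal ?_
  rw [gaussKernel, mul_assoc, ← Real.exp_add]
  refine mul_le_of_le_one_right (by positivity) (Real.exp_le_one_iff.2 ?_)
  have : -‖x - Real.exp (-t) • y‖ ^ 2 / (2 * sigma t ^ 2) +
      ‖x - Real.exp (-t) • y‖ ^ 2 / (4 * sigma t ^ 2) =
      -(‖x - Real.exp (-t) • y‖ ^ 2 / (4 * sigma t ^ 2)) := by
    field_simp; ring
  rw [this]
  exact neg_nonpos.2 (by positivity)

lemma measurable_smoothedDensity : Measurable (smoothedDensity q₀ t) := by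
  have h : StronglyMeasurable (Function.uncurry fun (x y : Vec d) =>
      gaussKernel d (sigma t) (x - Real.exp (-t) • y)) :=
    ((continuous_gaussKernel d _).comp
      (g := gaussKernel d (sigma t)) (f := fun p : Vec d × Vec d => p.1 - Real.exp (-t) • p.2)
      (by fun_prop)).stronglyMeasurable
  exact h.integral_prod_right.measurable

lemma measurable_lintegral_posterior {F : Vec d → Vec d → ℝ≥0∞}
    (hF : Measurable (Function.uncurry F)) :
    Measurable fun x => ∫⁻ y, F x y ∂(posterior q₀ t x) := by
  have : (fun x => ∫⁻ y, F x y ∂(posterior q₀ t x)) = fun x =>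
      (ENNReal.ofReal (smoothedDensity q₀ t x))⁻¹ *
      ∫⁻ y, ENNReal.ofReal (gaussKernel d (sigma t) (x - Real.exp (-t) • y)) * F x y ∂q₀ := by
    funext x
    exact lintegral_posterior q₀ x _ (hF.comp measurable_prodMk_left)
  rw [this]
  refine (measurable_smoothedDensity q₀).ennreal_ofReal.inv.mul
    (Measurable.lintegral_prod_right' (f := fun p : Vec d × Vec d =>
      ENNReal.ofReal (gaussKernel d (sigma t) (p.1 - Real.exp (-t) • p.2)) * F p.1 p.2) ?_)
  refine Measurable.mul (Continuous.measurable ?_).ennreal_ofReal hF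
  exact (continuous_gaussKernel d _).comp (by fun_prop)

lemma lintegral_smoothed (ht : 0 < t) {H : Vec d → ℝ≥0∞} (hH : Measurable H) :
    ∫⁻ x, H x ∂(smoothed q₀ t) = ∫⁻ x, ENNReal.ofReal (smoothedDensity q₀ t x) * H x := by
  rw [smoothed, lintegral_map hH (measurable_noised t),
    lintegral_sampleLaw q₀ ht (F := fun x _ => H x) (hH.comp measurable_fst)]
  refine lintegral_congr fun x => ?_
  rw [lintegral_mul_const _ (measurable_ofReal_gaussKernel_comp t x), ofReal_smoothedDensity q₀ ht]

/-- Disintegration of the joint law of `(x, z)` over the noised point `x`. -/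
lemma lintegral_sampleLaw_eq_smoothed (ht : 0 < t) {F : Vec d → Vec d → ℝ≥0∞}
    (hF : Measurable (Function.uncurry F)) :
    ∫⁻ p, F (noised t p.1 p.2) p.2 ∂(sampleLaw q₀ t) =
      ∫⁻ x, ∫⁻ y, F x (x - Real.exp (-t) • y) ∂(posterior q₀ t x) ∂(smoothed q₀ t) := by
  have hF' : Measurable (Function.uncurry fun x y : Vec d => F x (x - Real.exp (-t) • y)) :=
    hF.comp (g := Function.uncurry F)
      (f := fun p : Vec d × Vec d => (p.1, p.1 - Real.exp (-t) • p.2)) (by fun_prop)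
  rw [lintegral_sampleLaw q₀ ht hF,
    lintegral_smoothed q₀ ht (measurable_lintegral_posterior q₀ hF')]
  refine lintegral_congr fun x => ?_
  rw [lintegral_posterior q₀ x (fun y => F x (x - Real.exp (-t) • y))
    (hF'.comp measurable_prodMk_left), ← mul_assoc,
    ENNReal.mul_inv_cancel (by simpa using smoothedDensity_pos q₀ ht x) ENNReal.ofReal_ne_top,
    one_mul]

lemma integral_posterior {E : Type*} [NormedAddCommGroup E] [NormedSpace ℝ E] (ht : 0 < t)
    (x : Vec d) (f : Vec d → E) :
    ∫ y, f y ∂(posterior q₀ t x) = (smoothedDensity q₀ t x)⁻¹ •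
      ∫ y, gaussKernel d (sigma t) (x - Real.exp (-t) • y) • f y ∂q₀ := by
  rw [posterior, integral_smul_measure, ENNReal.toReal_inv,
    ENNReal.toReal_ofReal (smoothedDensity_pos q₀ ht x).le,
    integral_withDensity_eq_integral_toReal_smul (measurable_ofReal_gaussKernel_comp t x)
      (Filter.Eventually.of_forall fun _ => ENNReal.ofReal_lt_top)]
  simp_rw [ENNReal.toReal_ofReal (gaussKernel_pos d (sigma_pos ht) _).le]

lemma hasFDerivAt_gaussKernel (d : ℕ) {σ : ℝ} (hσ : 0 < σ) (v : Vec d) :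
    HasFDerivAt (gaussKernel d σ) (innerSL ℝ (gaussKernel d σ v • -((σ ^ 2)⁻¹ • v))) v := by
  have h1 : HasFDerivAt (fun v : Vec d => ‖v‖ ^ 2) (2 • innerSL ℝ v) v :=
    (hasStrictFDerivAt_norm_sq v).hasFDerivAt
  have h2 := (((h1.neg.mul_const ((2 * σ ^ 2)⁻¹)).exp).const_mul
    (((Real.sqrt (2 * Real.pi * σ ^ 2)) ^ d)⁻¹))
  refine (h2.congr_fderiv ?_)
  ext w
  simp only [gaussKernel, div_eq_mul_inv]
  simp
  field_simp

lemma norm_smul_gaussKernel_le (d : ℕ) {σ : ℝ} (hσ : 0 < σ) (v : Vec d) :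
    ‖gaussKernel d σ v • -((σ ^ 2)⁻¹ • v)‖ ≤ ((Real.sqrt (2 * Real.pi * σ ^ 2)) ^ d)⁻¹ * σ⁻¹ := by
  rw [norm_smul, norm_neg, norm_smul, Real.norm_eq_abs, abs_of_pos (gaussKernel_pos d hσ _),
    norm_inv, norm_pow, Real.norm_eq_abs, abs_of_pos hσ, gaussKernel, mul_assoc]
  gcongr
  have h1 : ‖v‖ / σ ≤ Real.exp (‖v‖ ^ 2 / (2 * σ ^ 2)) := by
    have := Real.add_one_le_exp (‖v‖ ^ 2 / (2 * σ ^ 2))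
    have h3 : ‖v‖ ^ 2 / (2 * σ ^ 2) = (‖v‖ / σ) ^ 2 / 2 := by field_simp
    nlinarith [sq_nonneg (‖v‖ / σ - 1)]
  rw [neg_div, Real.exp_neg]
  calc _ = σ⁻¹ * ((Real.exp (‖v‖ ^ 2 / (2 * σ ^ 2)))⁻¹ * (‖v‖ / σ)) := by
        field_simp
    _ ≤ σ⁻¹ * ((Real.exp (‖v‖ ^ 2 / (2 * σ ^ 2)))⁻¹ * Real.exp (‖v‖ ^ 2 / (2 * σ ^ 2))) := by
        gcongr
    _ = σ⁻¹ := by rw [inv_mul_cancel₀ (Real.exp_pos _).ne', mul_one]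

/-- Tweedie's formula: the score is the posterior mean of `-z / σ_t²`. -/
lemma score_eq_integral_posterior (ht : 0 < t) (x : Vec d) :
    score q₀ t x =
      ∫ y, -((sigma t ^ 2)⁻¹ • (x - Real.exp (-t) • y)) ∂(posterior q₀ t x) := by
  have hσ := sigma_pos ht
  set G : Vec d → Vec d → Vec d := fun x y => gaussKernel d (sigma t) (x - Real.exp (-t) • y) •
    -((sigma t ^ 2)⁻¹ • (x - Real.exp (-t) • y)) with hG
  have hGc : Continuous (G x) := by
    refine Continuous.smul ((continuous_gaussKernel d _).comp (by fun_prop)) (by fun_prop)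
  have hGI : Integrable (G x) q₀ := Integrable.of_bound hGc.aestronglyMeasurable _
    (Filter.Eventually.of_forall fun y => norm_smul_gaussKernel_le d hσ _)
  have hD : HasFDerivAt (smoothedDensity q₀ t) (∫ y, innerSL ℝ (G x y) ∂q₀) x := by
    refine hasFDerivAt_integral_of_dominated_of_fderiv_le (𝕜 := ℝ) (s := Set.univ)
      (F := fun x y => gaussKernel d (sigma t) (x - Real.exp (-t) • y))
      (F' := fun x y => innerSL ℝ (G x y))
      (bound := fun _ => ((Real.sqrt (2 * Real.pi * sigma t ^ 2)) ^ d)⁻¹ * (sigma t)⁻¹)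
      Filter.univ_mem ?_ (integrable_gaussKernel_comp q₀ ht x) ?_ ?_ (integrable_const _) ?_
    · exact Filter.Eventually.of_forall fun x' =>
        (integrable_gaussKernel_comp q₀ ht x').aestronglyMeasurable
    · exact ((innerSL ℝ).continuous.comp hGc).aestronglyMeasurable
    · refine Filter.Eventually.of_forall fun y x' _ => ?_
      rw [innerSL_apply_norm]
      exact norm_smul_gaussKernel_le d hσ _
    · refine Filter.Eventually.of_forall fun y x' _ => ?_
      exact (hasFDerivAt_gaussKernel d hσ (x' - Real.exp (-t) • y)).comp x'
        ((hasFDerivAt_id x').sub_const _)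
  have hD' : HasGradientAt (fun x' => Real.log (smoothedDensity q₀ t x'))
      ((smoothedDensity q₀ t x)⁻¹ • ∫ y, G x y ∂q₀) x := by
    rw [hasGradientAt_iff_hasFDerivAt]
    refine (hD.log (smoothedDensity_pos q₀ ht x).ne').congr_fderiv ?_
    rw [map_smul]
    congr 1
    ext w
    rw [ContinuousLinearMap.integral_apply ((innerSL ℝ).integrable_comp hGI)]
    simp only [innerSL_apply_apply, InnerProductSpace.toDual_apply_apply]
    rw [real_inner_comm, ← integral_inner hGI]
    simp_rw [real_inner_comm]
  rw [score, hD'.gradient, integral_posterior q₀ ht]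

end Posterior

/-! ### Chernoff's bound and the good set -/

section Chernoff

variable {Ω : Type*} [MeasurableSpace Ω] (μ : Measure Ω) [IsProbabilityMeasure μ]

lemma lintegral_pi_prod (m : ℕ) {F : Ω → ℝ≥0∞} (hF : Measurable F) :
    ∫⁻ ω, ∏ i, F (ω i) ∂(Measure.pi fun _ : Fin m => μ) = (∫⁻ x, F x ∂μ) ^ m := by
  rw [lintegral_prod_eq_prod_lintegral_of_indepFun Finset.univ
    (fun i (ω : Fin m → Ω) => F (ω i)) (iIndepFun_pi (μ := fun _ : Fin m => μ)
      (X := fun _ => F) fun _ => hF.aemeasurable) (fun i => hF.comp (measurable_pi_apply i))]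
  have : ∀ i : Fin m, ∫⁻ ω : Fin m → Ω, F (ω i) ∂(Measure.pi fun _ : Fin m => μ) =
      ∫⁻ x, F x ∂μ := fun i =>
    (measurePreserving_eval (fun _ : Fin m => μ) i).lintegral_comp hF
  simp [this]

/-- Chernoff's bound for a sum over an i.i.d. sample all of whose points lie in `S`. -/
lemma measure_pi_sum_ge_le (m : ℕ) {S : Set Ω} (hS : MeasurableSet S) {X : Ω → ℝ}
    (hX : Measurable X) {r : ℝ} (hr : 0 ≤ r)
    (h : ∫⁻ x, S.indicator (fun x => ENNReal.ofReal (Real.exp (X x))) x ∂μ ≤ ENNReal.ofReal r)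
    (c : ℝ) :
    (Measure.pi fun _ : Fin m => μ) {ω | (∀ i, ω i ∈ S) ∧ c ≤ ∑ i, X (ω i)} ≤
      ENNReal.ofReal (r ^ m * Real.exp (-c)) := by
  have hF : Measurable (S.indicator fun x => ENNReal.ofReal (Real.exp (X x))) :=
    (Measurable.ennreal_ofReal (by fun_prop)).indicator hS
  have hsub : {ω : Fin m → Ω | (∀ i, ω i ∈ S) ∧ c ≤ ∑ i, X (ω i)} ⊆
      {ω | ENNReal.ofReal (Real.exp c) ≤
        ∏ i, S.indicator (fun x => ENNReal.ofReal (Real.exp (X x))) (ω i)} := by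
    rintro ω ⟨h1, h2⟩
    have : ∀ i, S.indicator (fun x => ENNReal.ofReal (Real.exp (X x))) (ω i) =
        ENNReal.ofReal (Real.exp (X (ω i))) := fun i => Set.indicator_of_mem (h1 i) _
    simp only [Set.mem_ofPred_eq, this]
    rw [← ENNReal.ofReal_prod_of_nonneg (fun i _ => (Real.exp_pos _).le), ← Real.exp_sum]
    exact ENNReal.ofReal_le_ofReal (Real.exp_le_exp.2 h2)
  refine (measure_mono hsub).trans ?_
  have hmeas : Measurable fun ω : Fin m → Ω =>
      ∏ i, S.indicator (fun x => ENNReal.ofReal (Real.exp (X x))) (ω i) :=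
    Finset.measurable_prod _ fun i _ => hF.comp (measurable_pi_apply i)
  refine (meas_ge_le_lintegral_div hmeas.aemeasurable (by simp [Real.exp_pos])
    ENNReal.ofReal_ne_top).trans ?_
  rw [lintegral_pi_prod μ m hF, ENNReal.ofReal_mul (by positivity), Real.exp_neg,
    ENNReal.ofReal_inv_of_pos (Real.exp_pos _), ENNReal.ofReal_pow hr, div_eq_mul_inv]
  gcongr

lemma measure_pi_exists_le (m : ℕ) (S : Set Ω) :
    (Measure.pi fun _ : Fin m => μ) {ω | ∃ i, ω i ∈ S} ≤ m * μ S := by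
  have : {ω : Fin m → Ω | ∃ i, ω i ∈ S} = ⋃ i, (fun ω : Fin m → Ω => ω i) ⁻¹' S := by
    ext ω; simp
  rw [this]
  refine (measure_iUnion_fintype_le _ _).trans ?_
  have : ∀ i : Fin m, (Measure.pi fun _ : Fin m => μ) ((fun ω : Fin m → Ω => ω i) ⁻¹' S) ≤ μ S :=
    fun i => by
      have h := (measurePreserving_eval (fun _ : Fin m => μ) i)
      calc _ ≤ (Measure.pi fun _ : Fin m => μ)
            ((fun ω : Fin m → Ω => ω i) ⁻¹' (toMeasurable μ S)) :=
            measure_mono (Set.preimage_mono (subset_toMeasurable μ S))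
        _ = μ S := by
            rw [← measure_toMeasurable S]
            exact h.measure_preimage (measurableSet_toMeasurable μ S).nullMeasurableSet
  refine (Finset.sum_le_sum fun i _ => this i).trans ?_
  simp

end Chernoff

lemma lintegral_exp_sq_gaussianNoise (d : ℕ) {σ : ℝ} (hσ : 0 < σ) :
    ∫⁻ z, ENNReal.ofReal (Real.exp (‖z‖ ^ 2 / (4 * σ ^ 2))) ∂(gaussianNoise d σ) ≤
      ENNReal.ofReal (Real.exp d) := by
  rw [gaussianNoise_eq_withDensity d hσ, lintegral_withDensity_eq_lintegral_mul _
    (continuous_gaussKernel d σ).measurable.ennreal_ofReal (by fun_prop)]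
  have hb : 0 < 1 / (4 * σ ^ 2) := by positivity
  have h1 : ∀ z : Vec d, ((fun v : Vec d => ENNReal.ofReal (gaussKernel d σ v)) *
      fun v : Vec d => ENNReal.ofReal (Real.exp (‖v‖ ^ 2 / (4 * σ ^ 2)))) z =
      ENNReal.ofReal (((Real.sqrt (2 * Real.pi * σ ^ 2)) ^ d)⁻¹ *
        Real.exp (-(1 / (4 * σ ^ 2)) * ‖z‖ ^ 2)) := fun z => by
    rw [Pi.mul_apply, ← ENNReal.ofReal_mul (gaussKernel_pos d hσ _).le, gaussKernel, mul_assoc,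
      ← Real.exp_add]
    congr 3
    field_simp
    ring
  rw [lintegral_congr h1, ← ofReal_integral_eq_lintegral_ofReal
    ((integrable_exp_neg_mul_sq_norm d hb).const_mul _)
    (Filter.Eventually.of_forall fun z => by positivity), integral_const_mul,
    GaussianFourier.integral_rexp_neg_mul_sq_norm hb]
  refine ENNReal.ofReal_le_ofReal ?_
  simp only [finrank_euclideanSpace, Fintype.card_fin]
  rw [← sqrt_pow_eq_rpow (by positivity), ← inv_pow, ← mul_pow]
  have h2 : (Real.sqrt (2 * Real.pi * σ ^ 2))⁻¹ * Real.sqrt (Real.pi / (1 / (4 * σ ^ 2))) =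
      Real.sqrt 2 := by
    rw [← Real.sqrt_inv, ← Real.sqrt_mul (by positivity)]
    congr 1
    have := Real.pi_pos
    field_simp
    norm_num
  have h3 : Real.sqrt 2 ≤ Real.exp 1 := by
    have h4 : Real.sqrt 2 ≤ 2 := by
      rw [Real.sqrt_le_left (by norm_num)]; norm_num
    linarith [Real.add_one_le_exp 1]
  rw [h2, ← mul_one (d : ℝ), Real.exp_nat_mul]
  gcongr

/-- Markov's inequality for an exponential moment of size `exp d`. -/
lemma measure_exp_gt_le {d : ℕ} {Ω : Type*} [MeasurableSpace Ω] (μ : Measure Ω) {f : Ω → ℝ≥0∞}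
    (hf : Measurable f) (h : ∫⁻ x, f x ∂μ ≤ ENNReal.ofReal (Real.exp d)) (B : ℝ) :
    μ {x | ENNReal.ofReal (Real.exp B) < f x} ≤ ENNReal.ofReal (Real.exp (d - B)) := by
  refine (measure_mono fun x hx => (le_of_lt hx :
    ENNReal.ofReal (Real.exp B) ≤ f x)).trans ?_
  refine (meas_ge_le_lintegral_div hf.aemeasurable (by simp [Real.exp_pos])
    ENNReal.ofReal_ne_top).trans ?_
  rw [sub_eq_add_neg, Real.exp_add, ENNReal.ofReal_mul (Real.exp_pos _).le, Real.exp_neg,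
    ENNReal.ofReal_inv_of_pos (Real.exp_pos _), div_eq_mul_inv]
  gcongr

lemma gaussianNoise_norm_gt_le (d : ℕ) {σ : ℝ} (hσ : 0 < σ) (B : ℝ) :
    gaussianNoise d σ {z | 4 * σ ^ 2 * B < ‖z‖ ^ 2} ≤ ENNReal.ofReal (Real.exp (d - B)) := by
  refine (measure_mono fun z hz => ?_).trans (measure_exp_gt_le _
    (f := fun z => ENNReal.ofReal (Real.exp (‖z‖ ^ 2 / (4 * σ ^ 2)))) (by fun_prop)
    (lintegral_exp_sq_gaussianNoise d hσ) B)
  simp only [Set.mem_ofPred_eq] at hz ⊢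
  rw [ENNReal.ofReal_lt_ofReal_iff (Real.exp_pos _), Real.exp_lt_exp, lt_div_iff₀ (by positivity)]
  linarith

section GoodSet

variable {d : ℕ} (q₀ : Measure (Vec d)) {t : ℝ}

variable (t) in
/-- The points `x` at which the posterior exponential moment of order `1 / (4 σ_t²)` of `‖z‖²` is at
most `exp B`. -/
def goodSet (B : ℝ) : Set (Vec d) :=
  {x | ∫⁻ y, ENNReal.ofReal (Real.exp (‖x - Real.exp (-t) • y‖ ^ 2 / (4 * sigma t ^ 2)))
    ∂(posterior q₀ t x) ≤ ENNReal.ofReal (Real.exp B)}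

variable [IsProbabilityMeasure q₀]

lemma measurable_posterior_exp_sq : Measurable fun x => ∫⁻ y, ENNReal.ofReal
    (Real.exp (‖x - Real.exp (-t) • y‖ ^ 2 / (4 * sigma t ^ 2))) ∂(posterior q₀ t x) :=
  measurable_lintegral_posterior q₀ (F := fun x y => ENNReal.ofReal
    (Real.exp (‖x - Real.exp (-t) • y‖ ^ 2 / (4 * sigma t ^ 2)))) (by
      unfold Function.uncurry; fun_prop)

lemma measurableSet_goodSet (B : ℝ) : MeasurableSet (goodSet q₀ t B) :=
  measurableSet_le (measurable_posterior_exp_sq q₀) measurable_const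

lemma smoothed_compl_goodSet_le (ht : 0 < t) (B : ℝ) :
    smoothed q₀ t (goodSet q₀ t B)ᶜ ≤ ENNReal.ofReal (Real.exp (d - B)) := by
  have h : ∫⁻ x, ∫⁻ y, ENNReal.ofReal (Real.exp (‖x - Real.exp (-t) • y‖ ^ 2 / (4 * sigma t ^ 2)))
      ∂(posterior q₀ t x) ∂(smoothed q₀ t) ≤ ENNReal.ofReal (Real.exp d) := by
    rw [← lintegral_sampleLaw_eq_smoothed q₀ ht
      (F := fun _ z => ENNReal.ofReal (Real.exp (‖z‖ ^ 2 / (4 * sigma t ^ 2))))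
      (by unfold Function.uncurry; fun_prop), sampleLaw, lintegral_prod _ (by fun_prop)]
    simp only [lintegral_const, measure_univ, mul_one]
    exact lintegral_exp_sq_gaussianNoise d (sigma_pos ht)
  refine (measure_mono fun x hx => ?_).trans
    (measure_exp_gt_le _ (measurable_posterior_exp_sq q₀) h B)
  simpa [goodSet] using hx

variable {q₀}

lemma exp_sq_target (ht : 0 < t) (z : Vec d) :
    sigma t ^ 2 / 4 * ‖-((sigma t ^ 2)⁻¹ • z)‖ ^ 2 = ‖z‖ ^ 2 / (4 * sigma t ^ 2) := by
  have hσ := sigma_pos ht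
  rw [norm_neg, norm_smul, norm_inv, norm_pow, Real.norm_eq_abs, abs_of_pos hσ]
  field_simp

lemma integral_exp_le_of_mem_goodSet (ht : 0 < t) {B : ℝ} {x : Vec d} (hx : x ∈ goodSet q₀ t B) :
    ∫ y, Real.exp (sigma t ^ 2 / 4 * ‖-((sigma t ^ 2)⁻¹ • (x - Real.exp (-t) • y))‖ ^ 2)
      ∂(posterior q₀ t x) ≤ Real.exp B := by
  simp_rw [exp_sq_target ht]
  rw [← ENNReal.ofReal_le_ofReal_iff (Real.exp_pos _).le, ofReal_integral_eq_lintegral_ofReal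
    (integrable_exp_sq_posterior q₀ ht x)
    (Filter.Eventually.of_forall fun y => (Real.exp_pos _).le)]
  exact hx

lemma integrable_exp_target (ht : 0 < t) (x : Vec d) :
    Integrable (fun y => Real.exp (sigma t ^ 2 / 4 *
      ‖-((sigma t ^ 2)⁻¹ • (x - Real.exp (-t) • y))‖ ^ 2)) (posterior q₀ t x) := by
  simp_rw [exp_sq_target ht]
  exact integrable_exp_sq_posterior q₀ ht x

lemma integrable_target (ht : 0 < t) (x : Vec d) :
    Integrable (fun y => -((sigma t ^ 2)⁻¹ • (x - Real.exp (-t) • y))) (posterior q₀ t x) := by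
  have hσ := sigma_pos ht
  refine ((integrable_exp_target ht x).const_mul (4 / sigma t ^ 2 + 1)).mono'
    (Continuous.aestronglyMeasurable (by fun_prop)) (Filter.Eventually.of_forall fun y => ?_)
  set a := ‖-((sigma t ^ 2)⁻¹ • (x - Real.exp (-t) • y))‖
  have h1 := Real.add_one_le_exp (sigma t ^ 2 / 4 * a ^ 2)
  calc a ≤ (4 / sigma t ^ 2 + 1) * (sigma t ^ 2 / 4 * a ^ 2 + 1) := by
        have h2 : (4 / sigma t ^ 2 + 1) * (sigma t ^ 2 / 4 * a ^ 2 + 1) =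
          a ^ 2 + 1 + (4 / sigma t ^ 2 + sigma t ^ 2 / 4 * a ^ 2) := by
            field_simp
            ring
        have h3 : 0 ≤ 4 / sigma t ^ 2 + sigma t ^ 2 / 4 * a ^ 2 := by positivity
        nlinarith [sq_nonneg (a - 1)]
    _ ≤ _ := by gcongr

lemma sq_norm_score_le (ht : 0 < t) {B : ℝ} {x : Vec d} (hx : x ∈ goodSet q₀ t B) :
    ‖score q₀ t x‖ ^ 2 ≤ 4 * B / sigma t ^ 2 := by
  have hσ := sigma_pos ht
  have := isProbabilityMeasure_posterior q₀ ht x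
  have h := mul_sq_norm_integral_le (integrable_target ht x) (b := sigma t ^ 2 / 4) (B := B)
    (by positivity) (integrable_exp_target ht x) (integral_exp_le_of_mem_goodSet ht hx)
  rw [← score_eq_integral_posterior q₀ ht] at h
  rw [le_div_iff₀ (by positivity)]
  linarith

/-- On the good set the regression noise `-z / σ_t² - s_t(x)` is conditionally centred and
sub-Gaussian given `x`, with variance proxy of order `B / σ_t²`. -/
lemma lintegral_exp_inner_noise_le (ht : 0 < t) {B : ℝ} (hB : 1 ≤ B) {x : Vec d}
    (hx : x ∈ goodSet q₀ t B) (h : Vec d) :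
    ∫⁻ y, ENNReal.ofReal (Real.exp (inner ℝ h
      (-((sigma t ^ 2)⁻¹ • (x - Real.exp (-t) • y)) - score q₀ t x))) ∂(posterior q₀ t x) ≤
      ENNReal.ofReal (Real.exp (16 * B * ‖h‖ ^ 2 / sigma t ^ 2)) := by
  have hσ := sigma_pos ht
  have := isProbabilityMeasure_posterior q₀ ht x
  have key := integral_exp_inner_le (integrable_target ht x) (b := sigma t ^ 2 / 4) (B := B)
    (by positivity) hB (integrable_exp_target ht x) (integral_exp_le_of_mem_goodSet ht hx) h
  rw [← score_eq_integral_posterior q₀ ht] at key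
  rw [← ofReal_integral_eq_lintegral_ofReal key.1
    (Filter.Eventually.of_forall fun y => (Real.exp_pos _).le)]
  refine ENNReal.ofReal_le_ofReal (key.2.trans_eq ?_)
  congr 1
  field_simp
  ring

end GoodSet

/-! ### Exponential moments of the excess loss -/

section Excess

variable {d : ℕ} (q₀ : Measure (Vec d)) (t : ℝ)

/-- The excess of the score matching loss of `f` at the sample `p = (y, z)` over that of the
score. -/
noncomputable def excessLoss (f : Vec d → Vec d) (p : Vec d × Vec d) : ℝ :=
  ‖f (noised t p.1 p.2) - -((sigma t ^ 2)⁻¹ • p.2)‖ ^ 2 -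
    ‖score q₀ t (noised t p.1 p.2) - -((sigma t ^ 2)⁻¹ • p.2)‖ ^ 2

/-- The samples `(y, z)` whose noised point lies in `goodSet`. -/
def goodSamples (B : ℝ) : Set (Vec d × Vec d) :=
  (fun p => noised t p.1 p.2) ⁻¹' goodSet q₀ t B

lemma sq_norm_sub_sub_sq_norm_sub (a s u : Vec d) :
    ‖a - u‖ ^ 2 - ‖s - u‖ ^ 2 = ‖a - s‖ ^ 2 - 2 * inner ℝ (a - s) (u - s) := by
  have h : a - u = (a - s) - (u - s) := by abel
  rw [h, norm_sub_sq_real, norm_sub_rev s u]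
  ring

variable {q₀ t}

lemma measurable_excessLoss {f : Vec d → Vec d} (hf : Measurable f) :
    Measurable (excessLoss q₀ t f) := by
  have h1 := hf.comp (measurable_noised (d := d) t)
  have h2 := (measurable_score q₀ (t := t)).comp (measurable_noised (d := d) t)
  simp only [Function.comp_def] at h1 h2
  have h3 : Measurable fun p : Vec d × Vec d => -((sigma t ^ 2)⁻¹ • p.2) := by fun_prop
  exact ((h1.sub h3).norm.pow_const 2).sub ((h2.sub h3).norm.pow_const 2)

variable [IsProbabilityMeasure q₀]

lemma measurableSet_goodSamples (B : ℝ) : MeasurableSet (goodSamples q₀ t B) :=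
  measurable_noised t (measurableSet_goodSet q₀ B)

/-- A pointwise bound on the posterior exponential moments of `φ` integrates to a bound over the
good samples. -/
lemma lintegral_indicator_goodSamples_le (ht : 0 < t) {B : ℝ} {φ : Vec d → Vec d → ℝ}
    (hφ : Measurable (Function.uncurry φ)) {w : Vec d → ℝ≥0∞}
    (h : ∀ x ∈ goodSet q₀ t B, ∫⁻ y, ENNReal.ofReal (Real.exp (φ x (x - Real.exp (-t) • y)))
      ∂(posterior q₀ t x) ≤ w x) :
    ∫⁻ p, (goodSamples q₀ t B).indicator
      (fun p => ENNReal.ofReal (Real.exp (φ (noised t p.1 p.2) p.2))) p ∂(sampleLaw q₀ t) ≤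
      ∫⁻ x, w x ∂(smoothed q₀ t) := by
  have hF : Measurable (Function.uncurry fun x z => (goodSet q₀ t B).indicator
      (fun x => ENNReal.ofReal (Real.exp (φ x z))) x) := by
    have h1 : Measurable fun p : Vec d × Vec d => ENNReal.ofReal (Real.exp (φ p.1 p.2)) :=
      (Real.measurable_exp.comp hφ).ennreal_ofReal
    exact h1.indicator (measurable_fst (measurableSet_goodSet q₀ (t := t) B))
  have h2 := lintegral_sampleLaw_eq_smoothed q₀ ht hF
  refine (Eq.trans ?_ h2).trans_le (lintegral_mono fun x => ?_)
  · rfl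
  · by_cases hx : x ∈ goodSet q₀ t B
    · simpa only [Set.indicator_of_mem hx] using h x hx
    · simp only [Set.indicator_of_notMem hx, lintegral_zero, zero_le]

lemma lintegral_exp_add_inner_le (ht : 0 < t) {B : ℝ} (hB : 1 ≤ B) {x : Vec d}
    (hx : x ∈ goodSet q₀ t B) (a : ℝ) (h : Vec d) :
    ∫⁻ y, ENNReal.ofReal (Real.exp (a + inner ℝ h
      (-((sigma t ^ 2)⁻¹ • (x - Real.exp (-t) • y)) - score q₀ t x))) ∂(posterior q₀ t x) ≤
      ENNReal.ofReal (Real.exp (a + 16 * B * ‖h‖ ^ 2 / sigma t ^ 2)) := by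
  simp_rw [Real.exp_add, ENNReal.ofReal_mul (Real.exp_pos _).le]
  rw [lintegral_const_mul _ (by fun_prop)]
  gcongr
  exact lintegral_exp_inner_noise_le ht hB hx h

/-- The cross term `2 l ⟪g, ξ⟫` of the loss, with `l = σ_t² / (128 B)`, costs at most half of the
quadratic term `l ‖g‖²`. -/
lemma variance_proxy_eq {σ B : ℝ} (hσ : 0 < σ) (hB : 0 < B) (g : Vec d) {c : ℝ}
    (hc : c ^ 2 = (2 * (σ ^ 2 / (128 * B))) ^ 2) :
    16 * B * ‖c • g‖ ^ 2 / σ ^ 2 = σ ^ 2 / (128 * B) * ‖g‖ ^ 2 / 2 := by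
  rw [norm_smul, mul_pow, Real.norm_eq_abs, sq_abs, hc]
  field_simp
  ring

/-- For an estimator `f` far from the score, the lower exponential moment of the excess loss
decays. -/
lemma lintegral_exp_neg_excessLoss_le (ht : 0 < t) {B : ℝ} (hB : 1 ≤ B) {f : Vec d → Vec d}
    (hf : Measurable f) {ε δ : ℝ} (hε : 0 < ε) (hε1 : ε ≤ 1) (hδ : 0 < δ)
    (hbad : ENNReal.ofReal (δ / 2) ≤
      smoothed q₀ t {x | ε / (2 * sigma t) < ‖f x - score q₀ t x‖}) :
    ∫⁻ p, (goodSamples q₀ t B).indicator (fun p => ENNReal.ofReal (Real.exp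
      (-(sigma t ^ 2 / (128 * B) * excessLoss q₀ t f p)))) p ∂(sampleLaw q₀ t) ≤
      ENNReal.ofReal (Real.exp (-(δ * ε ^ 2 / (4096 * B)))) := by
  have hσ := sigma_pos ht
  set l := sigma t ^ 2 / (128 * B) with hl
  have hl0 : 0 < l := by positivity
  have hs := measurable_score q₀ (t := t)
  have h1 : ∫⁻ p, (goodSamples q₀ t B).indicator (fun p => ENNReal.ofReal (Real.exp
      (-(l * excessLoss q₀ t f p)))) p ∂(sampleLaw q₀ t) ≤
      ∫⁻ x, ENNReal.ofReal (Real.exp (-(l * ‖f x - score q₀ t x‖ ^ 2 / 2))) ∂(smoothed q₀ t) := by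
    refine lintegral_indicator_goodSamples_le (φ := fun x z => -(l *
      (‖f x - -((sigma t ^ 2)⁻¹ • z)‖ ^ 2 - ‖score q₀ t x - -((sigma t ^ 2)⁻¹ • z)‖ ^ 2))) ht
      (by unfold Function.uncurry; fun_prop) fun x hx => ?_
    have h2 := lintegral_exp_add_inner_le ht hB hx (-(l * ‖f x - score q₀ t x‖ ^ 2))
      ((2 * l) • (f x - score q₀ t x))
    rw [variance_proxy_eq hσ (by linarith) _ (by rw [hl])] at h2
    refine (le_of_eq (lintegral_congr fun y => ?_)).trans (h2.trans_eq ?_)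
    · rw [sq_norm_sub_sub_sq_norm_sub, real_inner_smul_left]
      congr 2; ring
    · rw [← hl]; congr 2; ring
  refine h1.trans ?_
  set bad := {x | ε / (2 * sigma t) < ‖f x - score q₀ t x‖} with hbad_def
  have hbm : MeasurableSet bad := measurableSet_lt measurable_const (by fun_prop)
  -- on the bad set the integrand is at most `exp (-a)`
  set a := l * (ε / (2 * sigma t)) ^ 2 / 2 with ha
  have ha' : a = ε ^ 2 / (1024 * B) := by
    rw [ha, hl]; field_simp; ring
  have ha0 : 0 ≤ a := by positivity
  have ha1 : a ≤ 1 / 2 := by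
    rw [ha', div_le_iff₀ (by positivity)]
    nlinarith
  have hpt : ∀ x, ENNReal.ofReal (Real.exp (-(l * ‖f x - score q₀ t x‖ ^ 2 / 2))) ≤
      badᶜ.indicator (fun _ => 1) x +
        bad.indicator (fun _ => ENNReal.ofReal (Real.exp (-a))) x := by
    intro x
    by_cases hx : x ∈ bad
    · rw [Set.indicator_of_mem hx, Set.indicator_of_notMem (by simpa using hx), zero_add]
      refine ENNReal.ofReal_le_ofReal (Real.exp_le_exp.2 (neg_le_neg ?_))
      have : ε / (2 * sigma t) ≤ ‖f x - score q₀ t x‖ := le_of_lt hx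
      rw [ha]
      gcongr
    · rw [Set.indicator_of_mem (by simpa using hx), Set.indicator_of_notMem hx, add_zero]
      refine ENNReal.ofReal_le_one.2 (Real.exp_le_one_iff.2 (neg_nonpos.2 (by positivity)))
  refine (lintegral_mono hpt).trans ?_
  rw [lintegral_add_left (measurable_const.indicator hbm.compl), lintegral_indicator hbm.compl,
    lintegral_indicator hbm]
  simp only [lintegral_const, one_mul, Measure.restrict_apply, MeasurableSet.univ, Set.univ_inter]
  set q := smoothed q₀ t with hq
  rw [← ofReal_measureReal (μ := q) (s := badᶜ), ← ofReal_measureReal (μ := q) (s := bad),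
    probReal_compl_eq_one_sub hbm]
  have hqb : δ / 2 ≤ q.real bad := by
    rw [← ofReal_measureReal (μ := q) (s := bad)] at hbad
    exact (ENNReal.ofReal_le_ofReal_iff measureReal_nonneg).1 hbad
  rw [← ENNReal.ofReal_mul (Real.exp_pos _).le, ← ENNReal.ofReal_add
    (by linarith [measureReal_le_one (μ := q) (s := bad)])
    (mul_nonneg (Real.exp_pos _).le measureReal_nonneg)]
  refine ENNReal.ofReal_le_ofReal ?_
  have he : Real.exp (-a) ≤ 1 - a / 2 := by
    have := Real.abs_exp_sub_one_sub_id_le (x := -a) (by rw [abs_neg, abs_of_nonneg ha0]; linarith)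
    nlinarith [(abs_le.1 this).2]
  have h3 := Real.add_one_le_exp (-(δ * ε ^ 2 / (4096 * B)))
  have h4 : δ * ε ^ 2 / (4096 * B) = δ / 2 * (a / 2) := by
    rw [ha']; field_simp; ring
  rw [h4] at h3 ⊢
  have h5 : Real.exp (-a) * q.real bad ≤ (1 - a / 2) * q.real bad := by gcongr
  have h6 : δ / 2 * (a / 2) ≤ q.real bad * (a / 2) := by gcongr
  linarith

/-- The upper exponential moment of the excess loss, beyond a multiple of the squared distance to
the score, is bounded. -/
lemma lintegral_exp_excessLoss_le (ht : 0 < t) {B : ℝ} (hB : 1 ≤ B) {f : Vec d → Vec d}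
    (hf : Measurable f) :
    ∫⁻ p, (goodSamples q₀ t B).indicator (fun p => ENNReal.ofReal (Real.exp
      (sigma t ^ 2 / (128 * B) * (excessLoss q₀ t f p - 3 / 2 *
        ‖f (noised t p.1 p.2) - score q₀ t (noised t p.1 p.2)‖ ^ 2)))) p ∂(sampleLaw q₀ t) ≤
      ENNReal.ofReal 1 := by
  have hσ := sigma_pos ht
  set l := sigma t ^ 2 / (128 * B) with hl
  have hs := measurable_score q₀ (t := t)
  have h1 : ∫⁻ p, (goodSamples q₀ t B).indicator (fun p => ENNReal.ofReal (Real.exp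
      (l * (excessLoss q₀ t f p - 3 / 2 *
        ‖f (noised t p.1 p.2) - score q₀ t (noised t p.1 p.2)‖ ^ 2)))) p ∂(sampleLaw q₀ t) ≤
      ∫⁻ _, ENNReal.ofReal 1 ∂(smoothed q₀ t) := by
    refine lintegral_indicator_goodSamples_le (φ := fun x z => l *
      (‖f x - -((sigma t ^ 2)⁻¹ • z)‖ ^ 2 - ‖score q₀ t x - -((sigma t ^ 2)⁻¹ • z)‖ ^ 2 -
        3 / 2 * ‖f x - score q₀ t x‖ ^ 2)) ht
      (by unfold Function.uncurry; fun_prop) fun x hx => ?_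
    have h2 := lintegral_exp_add_inner_le ht hB hx (-(l * ‖f x - score q₀ t x‖ ^ 2 / 2))
      ((-(2 * l)) • (f x - score q₀ t x))
    rw [variance_proxy_eq hσ (by linarith) _ (by rw [hl]; ring)] at h2
    refine (le_of_eq (lintegral_congr fun y => ?_)).trans (h2.trans_eq ?_)
    · rw [sq_norm_sub_sub_sq_norm_sub, real_inner_smul_left]
      congr 2; ring
    · rw [← hl, neg_add_cancel, Real.exp_zero]
  refine h1.trans (by simp)

end Excess

/-! ### Lipschitz bounds and parameter grids for ReLU networks -/

lemma norm_toLp_le_sum {b : ℕ} (f : Fin b → ℝ) : ‖(WithLp.toLp 2 f : Vec b)‖ ≤ ∑ i, |f i| := by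
  refine le_of_sq_le_sq ?_ (Finset.sum_nonneg fun i _ => abs_nonneg _)
  rw [EuclideanSpace.real_norm_sq_eq]
  calc ∑ i, f i ^ 2 = ∑ i, |f i| ^ 2 := by simp
    _ ≤ _ := Finset.sum_sq_le_sq_sum_of_nonneg fun i _ => abs_nonneg _

lemma abs_apply_le_norm {a : ℕ} (x : Vec a) (j : Fin a) : |x j| ≤ ‖x‖ := by
  simpa using PiLp.norm_apply_le x j

lemma layer_sub_left (bias : Bool) (a b : ℕ) (W W' : LayerIdx bias a b → ℝ) (x : Vec a) :
    layer bias a b W x - layer bias a b W' x = layer bias a b (W - W') x := by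
  cases bias
  · ext i
    change _ = ∑ j, (W (i, j) - W' (i, j)) * x j
    simp [layer, sub_mul, Finset.sum_sub_distrib]
  · ext i
    change _ = (∑ j, (W (i, some j) - W' (i, some j)) * x j) + (W (i, none) - W' (i, none))
    simp [layer, sub_mul, Finset.sum_sub_distrib]
    ring

lemma norm_layer_le (bias : Bool) (a b : ℕ) (W : LayerIdx bias a b → ℝ) (x : Vec a) {w : ℝ}
    (hW : ‖W‖ ≤ w) :
    ‖layer bias a b W x‖ ≤ Fintype.card (LayerIdx bias a b) * (w * (1 + ‖x‖)) := by
  have hw : 0 ≤ w := (norm_nonneg _).trans hW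
  have hWk : ∀ k, |W k| ≤ w := fun k => (norm_le_pi_norm W k).trans hW
  have hx := norm_nonneg x
  have h1 : ∀ k j, |W k * x j| ≤ w * (1 + ‖x‖) := fun k j => by
    rw [abs_mul]
    exact mul_le_mul (hWk k) ((abs_apply_le_norm x j).trans (by linarith)) (abs_nonneg _) hw
  have h2 : ∀ k, |W k| ≤ w * (1 + ‖x‖) := fun k => (hWk k).trans (by nlinarith)
  cases bias
  · refine (norm_toLp_le_sum _).trans ?_
    have hc : Fintype.card (LayerIdx false a b) = b * a := by
      change Fintype.card (Fin b × Fin a) = _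
      simp
    calc _ ≤ ∑ i : Fin b, ∑ j : Fin a, w * (1 + ‖x‖) := by
          refine Finset.sum_le_sum fun i _ => (Finset.abs_sum_le_sum_abs _ _).trans ?_
          exact Finset.sum_le_sum fun j _ => h1 _ _
      _ = _ := by rw [hc]; simp; ring
  · refine (norm_toLp_le_sum _).trans ?_
    have hc : Fintype.card (LayerIdx true a b) = b * (a + 1) := by
      change Fintype.card (Fin b × Option (Fin a)) = _
      simp
    calc _ ≤ ∑ i : Fin b, ((∑ j : Fin a, w * (1 + ‖x‖)) + w * (1 + ‖x‖)) := by
          refine Finset.sum_le_sum fun i _ => (abs_add_le _ _).trans (add_le_add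
            ((Finset.abs_sum_le_sum_abs _ _).trans ?_) (h2 _))
          exact Finset.sum_le_sum fun j _ => h1 _ _
      _ = _ := by rw [hc]; simp; ring

lemma norm_layer_sub_right_le (bias : Bool) (a b : ℕ) (W : LayerIdx bias a b → ℝ) (x x' : Vec a)
    {w : ℝ} (hW : ‖W‖ ≤ w) :
    ‖layer bias a b W x - layer bias a b W x'‖ ≤
      Fintype.card (LayerIdx bias a b) * (w * ‖x - x'‖) := by
  have hw : 0 ≤ w := (norm_nonneg _).trans hW
  have hWk : ∀ k, |W k| ≤ w := fun k => (norm_le_pi_norm W k).trans hW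
  have h1 : ∀ k j, |W k * (x j - x' j)| ≤ w * ‖x - x'‖ := fun k j => by
    rw [abs_mul]
    exact mul_le_mul (hWk k) (abs_apply_le_norm (x - x') j) (abs_nonneg _) hw
  have hsum : ∀ s : Fin b → Fin a → LayerIdx bias a b,
      ‖(WithLp.toLp 2 fun i => ∑ j, W (s i j) * (x j - x' j) : Vec b)‖ ≤
        (b * a : ℕ) * (w * ‖x - x'‖) := fun s => by
    refine (norm_toLp_le_sum _).trans ?_
    calc _ ≤ ∑ i : Fin b, ∑ j : Fin a, w * ‖x - x'‖ := by
          refine Finset.sum_le_sum fun i _ => (Finset.abs_sum_le_sum_abs _ _).trans ?_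
          exact Finset.sum_le_sum fun j _ => h1 _ _
      _ = _ := by simp; ring
  cases bias
  · have hc : Fintype.card (LayerIdx false a b) = b * a := by
      change Fintype.card (Fin b × Fin a) = _
      simp
    rw [hc]
    convert hsum (fun i j => (i, j)) using 2
    ext i
    simp [layer, mul_sub, Finset.sum_sub_distrib]
  · have hc : Fintype.card (LayerIdx true a b) = b * (a + 1) := by
      change Fintype.card (Fin b × Option (Fin a)) = _
      simp
    rw [hc]
    refine le_trans ?_ ((hsum (fun i j => (i, some j))).trans ?_)
    · refine le_of_eq (congrArg _ ?_)
      ext i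
      simp [layer, mul_sub, Finset.sum_sub_distrib]
    · gcongr
      omega

lemma norm_relu_sub_le {a : ℕ} (x x' : Vec a) : ‖relu x - relu x'‖ ≤ ‖x - x'‖ := by
  refine le_of_sq_le_sq ?_ (norm_nonneg _)
  rw [EuclideanSpace.real_norm_sq_eq, EuclideanSpace.real_norm_sq_eq]
  refine Finset.sum_le_sum fun i _ => ?_
  rw [sq_le_sq]
  simpa [relu] using abs_max_sub_max_le_abs (x i) (x' i) 0

lemma norm_relu_le {a : ℕ} (x : Vec a) : ‖relu x‖ ≤ ‖x‖ := by
  have h := norm_relu_sub_le x 0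
  have h0 : relu (0 : Vec a) = 0 := by ext i; simp [relu]
  simpa [h0] using h

lemma norm_layer_sub_le (bias : Bool) (a b : ℕ) (W W' : LayerIdx bias a b → ℝ) (x x' : Vec a)
    {w η M : ℝ} (hW' : ‖W'‖ ≤ w) (hη : ‖W - W'‖ ≤ η) (hw : 1 ≤ w)
    (hM : Fintype.card (LayerIdx bias a b) * w + 1 ≤ M) :
    ‖layer bias a b W x - layer bias a b W' x'‖ ≤ M * (η * (1 + ‖x‖) + ‖x - x'‖) := by
  have hη0 : 0 ≤ η := (norm_nonneg _).trans hη
  have h1 : ‖layer bias a b W x - layer bias a b W' x‖ ≤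
      Fintype.card (LayerIdx bias a b) * (η * (1 + ‖x‖)) := by
    rw [layer_sub_left]
    exact norm_layer_le bias a b _ x hη
  have h2 := norm_layer_sub_right_le bias a b W' x x' hW'
  set N : ℝ := (Fintype.card (LayerIdx bias a b) : ℝ)
  have hN : 0 ≤ N := Nat.cast_nonneg _
  have hNM : N ≤ M := by nlinarith
  have hNwM : N * w ≤ M := by linarith
  calc _ ≤ N * (η * (1 + ‖x‖)) + N * (w * ‖x - x'‖) :=
        (norm_sub_le_norm_sub_add_norm_sub _ _ _).trans (add_le_add h1 h2)
    _ = N * (η * (1 + ‖x‖)) + N * w * ‖x - x'‖ := by ring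
    _ ≤ M * (η * (1 + ‖x‖)) + M * ‖x - x'‖ := by gcongr
    _ = _ := by ring

/-- The network is Lipschitz in its parameters and its input, with constant exponential in the
depth. -/
lemma norm_network_sub_le (bias : Bool) (b : ℕ) {w η M : ℝ} (hw : 1 ≤ w) :
    ∀ (hidden : List ℕ) (a : ℕ) (θ θ' : ParamIdx bias b hidden a → ℝ) (x x' : Vec a),
      ‖θ‖ ≤ w → ‖θ'‖ ≤ w → ‖θ - θ'‖ ≤ η → numParams bias b hidden a * w + 1 ≤ M →
      ‖network bias b hidden a θ x - network bias b hidden a θ' x'‖ ≤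
        M ^ depth hidden * (depth hidden * η * (1 + ‖x‖) + ‖x - x'‖)
  | [], a, θ, θ', x, x', _, hθ', hη, hM => by
    have := norm_layer_sub_le bias a b θ θ' x x' hθ' hη hw hM
    change ‖layer bias a b θ x - layer bias a b θ' x'‖ ≤ _
    simpa [depth] using this
  | h :: hidden, a, θ, θ', x, x', hθ, hθ', hη, hM => by
    have hη0 : 0 ≤ η := (norm_nonneg _).trans hη
    have hcard : (numParams bias b (h :: hidden) a : ℝ) =
        Fintype.card (LayerIdx bias a h) + numParams bias b hidden h := by
      rw [← Nat.cast_add]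
      exact congrArg _ (Fintype.card_sum (α := LayerIdx bias a h) (β := ParamIdx bias b hidden h))
    rw [hcard] at hM
    have hN1 : (0 : ℝ) ≤ Fintype.card (LayerIdx bias a h) := Nat.cast_nonneg _
    have hN2 : (0 : ℝ) ≤ numParams bias b hidden h := Nat.cast_nonneg _
    have hM1 : Fintype.card (LayerIdx bias a h) * w + 1 ≤ M := by nlinarith
    have hM2 : numParams bias b hidden h * w + 1 ≤ M := by nlinarith
    have hM0 : 1 ≤ M := by nlinarith
    have hinl : ∀ (v : ParamIdx bias b (h :: hidden) a → ℝ) {c : ℝ}, ‖v‖ ≤ c →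
        ‖(fun k => v (Sum.inl k) : LayerIdx bias a h → ℝ)‖ ≤ c := fun v c hv =>
      (pi_norm_le_iff_of_nonneg ((norm_nonneg _).trans hv)).2 fun k =>
        (norm_le_pi_norm v (Sum.inl k)).trans hv
    have hinr : ∀ (v : ParamIdx bias b (h :: hidden) a → ℝ) {c : ℝ}, ‖v‖ ≤ c →
        ‖(fun k => v (Sum.inr k) : ParamIdx bias b hidden h → ℝ)‖ ≤ c := fun v c hv =>
      (pi_norm_le_iff_of_nonneg ((norm_nonneg _).trans hv)).2 fun k =>
        (norm_le_pi_norm v (Sum.inr k)).trans hv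
    set u := relu (layer bias a h (fun k => θ (Sum.inl k)) x) with hu
    set u' := relu (layer bias a h (fun k => θ' (Sum.inl k)) x') with hu'
    have h1 : ‖u - u'‖ ≤ M * (η * (1 + ‖x‖) + ‖x - x'‖) :=
      (norm_relu_sub_le _ _).trans (norm_layer_sub_le bias a h (fun k => θ (Sum.inl k))
        (fun k => θ' (Sum.inl k)) x x' (hinl θ' hθ') (hinl (θ - θ') hη) hw hM1)
    have h2 : 1 + ‖u‖ ≤ M * (1 + ‖x‖) := by
      have h3 : ‖u‖ ≤ Fintype.card (LayerIdx bias a h) * (w * (1 + ‖x‖)) :=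
        (norm_relu_le _).trans (norm_layer_le bias a h _ x (hinl θ hθ))
      nlinarith [norm_nonneg x]
    have ih := norm_network_sub_le bias b hw hidden h (fun k => θ (Sum.inr k))
      (fun k => θ' (Sum.inr k)) u u' (hinr θ hθ) (hinr θ' hθ') (hinr (θ - θ') hη) hM2
    calc _ ≤ M ^ depth hidden * (depth hidden * η * (1 + ‖u‖) + ‖u - u'‖) := ih
      _ ≤ M ^ depth hidden * (depth hidden * η * (M * (1 + ‖x‖)) +
          M * (η * (1 + ‖x‖) + ‖x - x'‖)) := by gcongr
      _ = _ := by
        simp only [depth, List.length_cons]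
        push_cast
        ring

lemma measurable_network (bias : Bool) (b : ℕ) (hidden : List ℕ) (a : ℕ)
    (θ : ParamIdx bias b hidden a → ℝ) : Measurable (network bias b hidden a θ) := by
  set w := max ‖θ‖ 1
  have hM0 : (0 : ℝ) ≤ numParams bias b hidden a * w + 1 := by positivity
  have h := fun x x' => norm_network_sub_le bias b (η := 0) (le_max_right ‖θ‖ 1) hidden a θ θ x x'
    (le_max_left _ _) (le_max_left _ _) (by simp) le_rfl
  have hL : LipschitzWith
      (Real.toNNReal ((numParams bias b hidden a * w + 1) ^ depth hidden))
      (network bias b hidden a θ) := by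
    refine LipschitzWith.of_dist_le_mul fun x x' => ?_
    rw [dist_eq_norm, dist_eq_norm, Real.coe_toNNReal _ (by positivity)]
    simpa using h x x'
  exact hL.continuous.measurable

/-- A grid in the cube of radius `Θ`. -/
lemma exists_finset_net (ι : Type*) [Fintype ι] {Θ : ℝ} (hΘ : 0 < Θ) {n : ℕ} (hn : 0 < n) :
    ∃ T : Finset (ι → ℝ), T.card ≤ (n + 1) ^ Fintype.card ι ∧ (∀ θ ∈ T, ‖θ‖ ≤ Θ) ∧
      ∀ θ : ι → ℝ, ‖θ‖ ≤ Θ → ∃ θ' ∈ T, ‖θ - θ'‖ ≤ 2 * Θ / n := by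
  classical
  have hn' : (0 : ℝ) < n := Nat.cast_pos.2 hn
  let g : (ι → Fin (n + 1)) → ι → ℝ := fun k j => -Θ + 2 * Θ / n * (k j : ℕ)
  refine ⟨Finset.univ.image g, ?_, ?_, ?_⟩
  · refine Finset.card_image_le.trans ?_
    simp
  · intro θ hθ
    obtain ⟨k, -, rfl⟩ := Finset.mem_image.1 hθ
    refine (pi_norm_le_iff_of_nonneg hΘ.le).2 fun j => ?_
    have h1 : ((k j : ℕ) : ℝ) ≤ n := by exact_mod_cast Nat.lt_succ_iff.1 (k j).2
    have h2 : 2 * Θ / n * (k j : ℕ) ≤ 2 * Θ := by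
      calc _ ≤ 2 * Θ / n * n := by gcongr
        _ = _ := by field_simp
    have h3 : 0 ≤ 2 * Θ / n * (k j : ℕ) := by positivity
    rw [Real.norm_eq_abs, abs_le]
    constructor <;> simp only [g] <;> linarith
  · intro θ hθ
    have hj : ∀ j, |θ j| ≤ Θ := fun j => (norm_le_pi_norm θ j).trans hθ
    have hpos : ∀ j, 0 ≤ (θ j + Θ) * n / (2 * Θ) := fun j => by
      have := (abs_le.1 (hj j)).1
      have : 0 ≤ θ j + Θ := by linarith
      positivity
    have hlt : ∀ j, ⌊(θ j + Θ) * n / (2 * Θ)⌋₊ < n + 1 := fun j => by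
      rw [Nat.lt_succ_iff]
      refine Nat.floor_le_of_le ?_
      rw [div_le_iff₀ (by positivity)]
      have := (abs_le.1 (hj j)).2
      nlinarith
    refine ⟨g fun j => ⟨_, hlt j⟩, Finset.mem_image_of_mem _ (Finset.mem_univ _), ?_⟩
    refine (pi_norm_le_iff_of_nonneg (by positivity)).2 fun j => ?_
    have h1 := Nat.floor_le (hpos j)
    have h2 := Nat.lt_floor_add_one ((θ j + Θ) * n / (2 * Θ))
    have h3 : θ j + Θ = 2 * Θ / n * ((θ j + Θ) * n / (2 * Θ)) := by field_simp
    have h4 : 0 < 2 * Θ / n := by positivity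
    simp only [Pi.sub_apply, g, Real.norm_eq_abs]
    rw [abs_le]
    constructor <;> nlinarith

/-! ### Comparison of empirical losses -/

lemma sampleLaw_fst_preimage {d : ℕ} (q₀ : Measure (Vec d)) [SFinite q₀] (t : ℝ) (A : Set (Vec d)) :
    sampleLaw q₀ t {p | p.1 ∈ A} = q₀ A := by
  have : {p : Vec d × Vec d | p.1 ∈ A} = A ×ˢ Set.univ := by ext; simp
  rw [this, sampleLaw, Measure.prod_prod, measure_univ, mul_one]

lemma measure_norm_gt_le {d : ℕ} {q₀ : Measure (Vec d)} {m₂ : ℝ}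
    (h : ∫⁻ y, ‖y‖ₑ ^ 2 ∂q₀ = ENNReal.ofReal (m₂ ^ 2)) {r : ℝ} (hr : 0 < r) : q₀ {y | r < ‖y‖} ≤ ENNReal.ofReal (m₂ ^ 2 / r ^ 2) := by
  have hsub : {y : Vec d | r < ‖y‖} ⊆ {y | ENNReal.ofReal (r ^ 2) ≤ ‖y‖ₑ ^ 2} := fun y hy => by
    simp only [Set.mem_ofPred_eq] at hy ⊢
    rw [← ofReal_norm, ← ENNReal.ofReal_pow (norm_nonneg _)]
    exact ENNReal.ofReal_le_ofReal (by gcongr)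
  refine (measure_mono hsub).trans ((meas_ge_le_lintegral_div (by fun_prop)
    (by simp; positivity) ENNReal.ofReal_ne_top).trans_eq ?_)
  rw [h, ENNReal.ofReal_div_of_pos (by positivity)]

section EmpiricalRisk

variable {d : ℕ} {q₀ : Measure (Vec d)} [IsProbabilityMeasure q₀] {t : ℝ}

lemma sq_norm_score_sub_target_le (ht : 0 < t) {B : ℝ} {p : Vec d × Vec d}
    (hp : p ∈ goodSamples q₀ t B) (hz : ‖p.2‖ ^ 2 ≤ 4 * sigma t ^ 2 * B) :
    ‖score q₀ t (noised t p.1 p.2) - -((sigma t ^ 2)⁻¹ • p.2)‖ ^ 2 ≤ 16 * B / sigma t ^ 2 := by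
  have hσ := sigma_pos ht
  have h1 : ‖score q₀ t (noised t p.1 p.2)‖ ^ 2 ≤ 4 * B / sigma t ^ 2 := sq_norm_score_le ht hp
  have h2 : ‖-((sigma t ^ 2)⁻¹ • p.2)‖ ^ 2 ≤ 4 * B / sigma t ^ 2 := by
    have := exp_sq_target ht p.2
    rw [le_div_iff₀ (by positivity)]
    have h3 : ‖p.2‖ ^ 2 / (4 * sigma t ^ 2) ≤ B := by
      rw [div_le_iff₀ (by positivity)]; linarith
    linarith
  have h3 := norm_sub_le (score q₀ t (noised t p.1 p.2)) (-((sigma t ^ 2)⁻¹ • p.2))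
  set a := ‖score q₀ t (noised t p.1 p.2)‖
  set b := ‖-((sigma t ^ 2)⁻¹ • p.2)‖
  calc _ ≤ (a + b) ^ 2 := by gcongr
    _ ≤ 2 * a ^ 2 + 2 * b ^ 2 := by nlinarith [sq_nonneg (a - b)]
    _ ≤ 2 * (4 * B / sigma t ^ 2) + 2 * (4 * B / sigma t ^ 2) := by gcongr
    _ = _ := by ring

/-- If `f` has empirical loss at most that of `fs`, whose excess loss is small, then any `f'`
uniformly close to `f` on the sample has small excess loss. -/
lemma sum_excessLoss_le_of_close (ht : 0 < t) {m : ℕ} (hm : 0 < m) {ω : Fin m → Vec d × Vec d}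
    {B τ γ ρ : ℝ} (hγ : 0 < γ) (hγ1 : γ ≤ 1)
    (hgood : ∀ i, ω i ∈ goodSamples q₀ t B) (hz : ∀ i, ‖(ω i).2‖ ^ 2 ≤ 4 * sigma t ^ 2 * B)
    {f fs f' : Vec d → Vec d} (hmin : empiricalLoss t ω f ≤ empiricalLoss t ω fs)
    (hs : ∑ i, excessLoss q₀ t fs (ω i) ≤ τ)
    (hclose : ∀ i, ‖f (noised t (ω i).1 (ω i).2) - f' (noised t (ω i).1 (ω i).2)‖ ≤ ρ)
    (hτB : γ * (m * (16 * B / sigma t ^ 2)) ≤ τ) (hτρ : 2 * m * ρ ^ 2 / γ ≤ τ) :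
    ∑ i, excessLoss q₀ t f' (ω i) ≤ 4 * τ := by
  have hm' : (0 : ℝ) < m := Nat.cast_pos.2 hm
  have hτ : 0 ≤ τ := le_trans (by positivity) hτρ
  let x := fun i => noised t (ω i).1 (ω i).2
  let u := fun i => -((sigma t ^ 2)⁻¹ • (ω i).2)
  have hmin' : ∑ i, ‖f (x i) - u i‖ ^ 2 ≤ ∑ i, ‖fs (x i) - u i‖ ^ 2 :=
    le_of_mul_le_mul_left hmin (by positivity)
  have hSs : ∑ i, ‖score q₀ t (x i) - u i‖ ^ 2 ≤ m * (16 * B / sigma t ^ 2) := by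
    calc _ ≤ ∑ _i : Fin m, 16 * B / sigma t ^ 2 :=
          Finset.sum_le_sum fun i _ => sq_norm_score_sub_target_le ht (hgood i) (hz i)
      _ = _ := by simp
  have hex : ∀ g : Vec d → Vec d, ∑ i, excessLoss q₀ t g (ω i) =
      ∑ i, ‖g (x i) - u i‖ ^ 2 - ∑ i, ‖score q₀ t (x i) - u i‖ ^ 2 := fun g =>
    Finset.sum_sub_distrib _ _
  have hpt : ∀ i, ‖f' (x i) - u i‖ ^ 2 ≤
      (1 + γ) * ‖f (x i) - u i‖ ^ 2 + (1 + 1 / γ) * ρ ^ 2 := by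
    intro i
    have h1 : ‖f' (x i) - u i‖ ≤ ‖f (x i) - u i‖ + ρ := by
      have h2 : f' (x i) - u i = (f (x i) - u i) - (f (x i) - f' (x i)) := by abel
      rw [h2]
      exact (norm_sub_le _ _).trans (by gcongr; exact hclose i)
    set a := ‖f (x i) - u i‖
    have h3 : (1 + γ) * a ^ 2 + (1 + 1 / γ) * ρ ^ 2 - (a + ρ) ^ 2 = (γ * a - ρ) ^ 2 / γ := by
      field_simp; ring
    have h4 : 0 ≤ (γ * a - ρ) ^ 2 / γ := by positivity
    have h5 : ‖f' (x i) - u i‖ ^ 2 ≤ (a + ρ) ^ 2 := by gcongr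
    linarith
  have hsum : ∑ i, ‖f' (x i) - u i‖ ^ 2 ≤
      (1 + γ) * ∑ i, ‖f (x i) - u i‖ ^ 2 + m * ((1 + 1 / γ) * ρ ^ 2) := by
    refine (Finset.sum_le_sum fun i _ => hpt i).trans_eq ?_
    rw [Finset.sum_add_distrib, ← Finset.mul_sum]
    simp
  rw [hex] at hs ⊢
  have hρ : m * ((1 + 1 / γ) * ρ ^ 2) ≤ τ := by
    refine le_trans ?_ hτρ
    have h1 : 1 + 1 / γ ≤ 2 / γ := by
      rw [le_div_iff₀ hγ, add_mul, one_div, inv_mul_cancel₀ hγ.ne']; linarith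
    calc _ ≤ m * (2 / γ * ρ ^ 2) := by gcongr
      _ = _ := by ring
  set S := ∑ i, ‖score q₀ t (x i) - u i‖ ^ 2
  set Sf := ∑ i, ‖f (x i) - u i‖ ^ 2
  have h1 : Sf ≤ S + τ := by linarith
  have h2 : γ * S ≤ τ := (mul_le_mul_of_nonneg_left hSs hγ.le).trans hτB
  nlinarith

lemma sampleLaw_snd_preimage (A : Set (Vec d)) :
    sampleLaw q₀ t {p | p.2 ∈ A} = gaussianNoise d (sigma t) A := by
  have : {p : Vec d × Vec d | p.2 ∈ A} = Set.univ ×ˢ A := by ext; simp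
  rw [this, sampleLaw, Measure.prod_prod, measure_univ, one_mul]

lemma norm_noised_le (ht : 0 < t) {y z : Vec d} {R₁ B : ℝ} (hB : 0 ≤ B) (hy : ‖y‖ ≤ R₁)
    (hz : ‖z‖ ^ 2 ≤ 4 * sigma t ^ 2 * B) : ‖noised t y z‖ ≤ R₁ + 2 * Real.sqrt B := by
  have hz' : ‖z‖ ≤ 2 * Real.sqrt B := by
    refine le_of_sq_le_sq (hz.trans ?_) (by positivity)
    rw [mul_pow, Real.sq_sqrt hB]
    have h1 := sigma_le_one ht
    have h2 : sigma t ^ 2 ≤ 1 := pow_le_one₀ (sigma_pos ht).le h1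
    nlinarith
  have he : Real.exp (-t) ≤ 1 := Real.exp_le_one_iff.2 (by linarith)
  refine (norm_add_le _ _).trans (add_le_add ?_ hz')
  rw [norm_smul, Real.norm_eq_abs, Real.abs_exp]
  nlinarith [norm_nonneg y]

end EmpiricalRisk

/-! ### The union bound -/

section Probability

variable {d : ℕ} {q₀ : Measure (Vec d)} [IsProbabilityMeasure q₀] {t : ℝ}

/-- With high probability all noised points are good. -/
lemma measure_pi_exists_notMem_goodSamples_le (ht : 0 < t) (m : ℕ) {B δ : ℝ}
    (hB : m * Real.exp (d - B) ≤ δ) :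
    (Measure.pi fun _ : Fin m => sampleLaw q₀ t) {ω | ∃ i, ω i ∈ (goodSamples q₀ t B)ᶜ} ≤
      ENNReal.ofReal δ := by
  refine (measure_pi_exists_le _ m _).trans ?_
  have h : sampleLaw q₀ t (goodSamples q₀ t B)ᶜ = smoothed q₀ t (goodSet q₀ t B)ᶜ := by
    rw [smoothed, Measure.map_apply (measurable_noised t) (measurableSet_goodSet q₀ B).compl]
    rfl
  calc _ ≤ (m : ℝ≥0∞) * ENNReal.ofReal (Real.exp (d - B)) := by
        rw [h]; gcongr; exact smoothed_compl_goodSet_le q₀ ht B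
    _ = ENNReal.ofReal (m * Real.exp (d - B)) := by
        rw [ENNReal.ofReal_mul (Nat.cast_nonneg _), ENNReal.ofReal_natCast]
    _ ≤ _ := ENNReal.ofReal_le_ofReal hB

lemma measure_pi_exists_snd_gt_le (ht : 0 < t) (m : ℕ) {B δ : ℝ}
    (hB : m * Real.exp (d - B) ≤ δ) :
    (Measure.pi fun _ : Fin m => sampleLaw q₀ t)
      {ω | ∃ i, ω i ∈ {p : Vec d × Vec d | p.2 ∈ {z : Vec d | 4 * sigma t ^ 2 * B < ‖z‖ ^ 2}}} ≤
      ENNReal.ofReal δ := by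
  refine (measure_pi_exists_le _ m _).trans ?_
  rw [sampleLaw_snd_preimage]
  calc _ ≤ (m : ℝ≥0∞) * ENNReal.ofReal (Real.exp (d - B)) := by
        gcongr; exact gaussianNoise_norm_gt_le d (sigma_pos ht) B
    _ = ENNReal.ofReal (m * Real.exp (d - B)) := by
        rw [ENNReal.ofReal_mul (Nat.cast_nonneg _), ENNReal.ofReal_natCast]
    _ ≤ _ := ENNReal.ofReal_le_ofReal hB

lemma measure_pi_exists_fst_gt_le (m : ℕ) {m₂ r δ : ℝ}
    (h : ∫⁻ y, ‖y‖ₑ ^ 2 ∂q₀ = ENNReal.ofReal (m₂ ^ 2)) (hr : 0 < r)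
    (hδ : m * (m₂ ^ 2 / r ^ 2) ≤ δ) :
    (Measure.pi fun _ : Fin m => sampleLaw q₀ t)
      {ω | ∃ i, ω i ∈ {p : Vec d × Vec d | p.1 ∈ {y : Vec d | r < ‖y‖}}} ≤ ENNReal.ofReal δ := by
  refine (measure_pi_exists_le _ m _).trans ?_
  rw [sampleLaw_fst_preimage]
  calc _ ≤ (m : ℝ≥0∞) * ENNReal.ofReal (m₂ ^ 2 / r ^ 2) := by
        gcongr; exact measure_norm_gt_le h hr
    _ = ENNReal.ofReal (m * (m₂ ^ 2 / r ^ 2)) := by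
        rw [ENNReal.ofReal_mul (Nat.cast_nonneg _), ENNReal.ofReal_natCast]
    _ ≤ _ := ENNReal.ofReal_le_ofReal hδ

/-- Tail bound for the norm of the noised point. -/
lemma smoothed_norm_gt_le (ht : 0 < t) {m₂ r B δ₁ δ₂ : ℝ}
    (h : ∫⁻ y, ‖y‖ₑ ^ 2 ∂q₀ = ENNReal.ofReal (m₂ ^ 2)) (hr : 0 < r) (hB : 0 ≤ B)
    (h₁ : m₂ ^ 2 / r ^ 2 ≤ δ₁) (h₂ : Real.exp (d - B) ≤ δ₂) :
    smoothed q₀ t {x | r + 2 * Real.sqrt B < ‖x‖} ≤ ENNReal.ofReal (δ₁ + δ₂) := by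
  have hδ₁ : 0 ≤ δ₁ := le_trans (by positivity) h₁
  have hδ₂ : 0 ≤ δ₂ := le_trans (by positivity) h₂
  rw [smoothed, Measure.map_apply (measurable_noised t)
    (measurableSet_lt measurable_const measurable_norm)]
  have hsub : (fun p : Vec d × Vec d => noised t p.1 p.2) ⁻¹' {x | r + 2 * Real.sqrt B < ‖x‖} ⊆
      {p | p.1 ∈ {y : Vec d | r < ‖y‖}} ∪
        {p | p.2 ∈ {z : Vec d | 4 * sigma t ^ 2 * B < ‖z‖ ^ 2}} := by
    intro p hp
    by_contra hcon
    simp only [Set.mem_union, Set.mem_ofPred_eq, not_or, not_lt] at hcon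
    exact absurd (norm_noised_le ht hB hcon.1 hcon.2) (not_le.2 hp)
  refine (measure_mono hsub).trans ((measure_union_le _ _).trans ?_)
  rw [sampleLaw_fst_preimage, sampleLaw_snd_preimage, ENNReal.ofReal_add hδ₁ hδ₂]
  exact add_le_add ((measure_norm_gt_le h hr).trans (ENNReal.ofReal_le_ofReal h₁))
    ((gaussianNoise_norm_gt_le d (sigma_pos ht) B).trans (ENNReal.ofReal_le_ofReal h₂))

/-- Markov's inequality for the empirical squared distance to the score. -/
lemma measure_pi_sum_sq_gt_le (m : ℕ) {f : Vec d → Vec d} (hf : Measurable f) {e c : ℝ}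
    (hc : 0 < c) (h : ∫⁻ x, ‖f x - score q₀ t x‖ₑ ^ 2 ∂(smoothed q₀ t) ≤ ENNReal.ofReal e) :
    (Measure.pi fun _ : Fin m => sampleLaw q₀ t) {ω | c < ∑ i,
      ‖f (noised t (ω i).1 (ω i).2) - score q₀ t (noised t (ω i).1 (ω i).2)‖ ^ 2} ≤
      ENNReal.ofReal (m * e / c) := by
  have hs := measurable_score q₀ (t := t)
  have hg : Measurable fun x => ‖f x - score q₀ t x‖ₑ ^ 2 := by fun_prop
  have hgp : Measurable fun p : Vec d × Vec d =>
      ‖f (noised t p.1 p.2) - score q₀ t (noised t p.1 p.2)‖ₑ ^ 2 :=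
    hg.comp (measurable_noised t)
  have hgi : ∀ i : Fin m, Measurable fun ω : Fin m → Vec d × Vec d =>
      ‖f (noised t (ω i).1 (ω i).2) - score q₀ t (noised t (ω i).1 (ω i).2)‖ₑ ^ 2 := fun i =>
    hgp.comp (measurable_pi_apply i)
  have hint : ∀ i : Fin m, ∫⁻ ω : Fin m → Vec d × Vec d,
      ‖f (noised t (ω i).1 (ω i).2) - score q₀ t (noised t (ω i).1 (ω i).2)‖ₑ ^ 2
      ∂(Measure.pi fun _ : Fin m => sampleLaw q₀ t) ≤ ENNReal.ofReal e := fun i => by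
    refine le_trans (le_of_eq ?_) h
    rw [smoothed, lintegral_map hg (measurable_noised t)]
    exact (measurePreserving_eval (fun _ : Fin m => sampleLaw q₀ t) i).lintegral_comp hgp
  have hsub : {ω : Fin m → Vec d × Vec d | c < ∑ i,
      ‖f (noised t (ω i).1 (ω i).2) - score q₀ t (noised t (ω i).1 (ω i).2)‖ ^ 2} ⊆
      {ω | ENNReal.ofReal c ≤ ∑ i,
      ‖f (noised t (ω i).1 (ω i).2) - score q₀ t (noised t (ω i).1 (ω i).2)‖ₑ ^ 2} := fun ω hω => by
    simp only [Set.mem_ofPred_eq] at hω ⊢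
    simp_rw [← ofReal_norm, ← ENNReal.ofReal_pow (norm_nonneg _)]
    rw [← ENNReal.ofReal_sum_of_nonneg fun i _ => by positivity]
    exact ENNReal.ofReal_le_ofReal hω.le
  refine (measure_mono hsub).trans ((meas_ge_le_lintegral_div
    (Finset.measurable_sum _ fun i _ => hgi i).aemeasurable (by simpa using hc)
    ENNReal.ofReal_ne_top).trans ?_)
  rw [lintegral_finsetSum _ fun i _ => hgi i, ENNReal.ofReal_div_of_pos hc,
    ENNReal.ofReal_mul (Nat.cast_nonneg _), ENNReal.ofReal_natCast]
  gcongr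
  refine (Finset.sum_le_sum fun i _ => hint i).trans ?_
  simp

/-- An estimator far from the score has a small excess loss on a good sample only with
exponentially small probability. -/
lemma measure_pi_excessLoss_le_le (ht : 0 < t) (m : ℕ) {B : ℝ} (hB : 1 ≤ B) {f : Vec d → Vec d}
    (hf : Measurable f) {ε δ : ℝ} (hε : 0 < ε) (hε1 : ε ≤ 1) (hδ : 0 < δ)
    (hbad : ENNReal.ofReal (δ / 2) ≤
      smoothed q₀ t {x | ε / (2 * sigma t) < ‖f x - score q₀ t x‖}) :
    (Measure.pi fun _ : Fin m => sampleLaw q₀ t) {ω | (∀ i, ω i ∈ goodSamples q₀ t B) ∧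
      ∑ i, excessLoss q₀ t f (ω i) ≤ 4 * (m * δ * ε ^ 2 / (256 * sigma t ^ 2))} ≤
      ENNReal.ofReal (Real.exp (-(m * δ * ε ^ 2 / (8192 * B)))) := by
  have hσ := sigma_pos ht
  have hX : Measurable fun p => -(sigma t ^ 2 / (128 * B) * excessLoss q₀ t f p) :=
    ((measurable_excessLoss hf).const_mul _).neg
  have h := measure_pi_sum_ge_le (sampleLaw q₀ t) m (measurableSet_goodSamples B) hX
    (Real.exp_pos _).le (lintegral_exp_neg_excessLoss_le ht hB hf hε hε1 hδ hbad)
    (-(m * δ * ε ^ 2 / (8192 * B)))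
  refine (measure_mono ?_).trans (h.trans_eq ?_)
  · intro ω hω
    refine ⟨hω.1, ?_⟩
    rw [Finset.sum_neg_distrib, ← Finset.mul_sum, neg_le_neg_iff]
    calc _ ≤ sigma t ^ 2 / (128 * B) * (4 * (m * δ * ε ^ 2 / (256 * sigma t ^ 2))) := by
          gcongr; exact hω.2
      _ = _ := by field_simp; ring
  · rw [← Real.exp_nat_mul, ← Real.exp_add]
    congr 2
    field_simp
    ring

/-- The excess loss of an estimator is at most of the order of its empirical squared distance to
the score, up to an additive term. -/
lemma measure_pi_excessLoss_ge_le (ht : 0 < t) (m : ℕ) {B : ℝ} (hB : 1 ≤ B) {f : Vec d → Vec d}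
    (hf : Measurable f) (c : ℝ) :
    (Measure.pi fun _ : Fin m => sampleLaw q₀ t) {ω | (∀ i, ω i ∈ goodSamples q₀ t B) ∧
      128 * B / sigma t ^ 2 * c + 3 / 2 * ∑ i,
        ‖f (noised t (ω i).1 (ω i).2) - score q₀ t (noised t (ω i).1 (ω i).2)‖ ^ 2 ≤
        ∑ i, excessLoss q₀ t f (ω i)} ≤ ENNReal.ofReal (Real.exp (-c)) := by
  have hσ := sigma_pos ht
  have hs := measurable_score q₀ (t := t)
  have hgp : Measurable fun p : Vec d × Vec d =>
      ‖f (noised t p.1 p.2) - score q₀ t (noised t p.1 p.2)‖ ^ 2 :=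
    ((hf.sub hs).norm.pow_const 2).comp (measurable_noised t)
  have hX : Measurable fun p => sigma t ^ 2 / (128 * B) * (excessLoss q₀ t f p - 3 / 2 *
      ‖f (noised t p.1 p.2) - score q₀ t (noised t p.1 p.2)‖ ^ 2) :=
    ((measurable_excessLoss hf).sub (hgp.const_mul _)).const_mul _
  have h := measure_pi_sum_ge_le (sampleLaw q₀ t) m (measurableSet_goodSamples B) hX
    zero_le_one (lintegral_exp_excessLoss_le ht hB hf) c
  refine (measure_mono ?_).trans (h.trans_eq (by simp))
  intro ω hω
  refine ⟨hω.1, ?_⟩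
  rw [← Finset.mul_sum, Finset.sum_sub_distrib, ← Finset.mul_sum]
  have h2 := hω.2
  calc c = sigma t ^ 2 / (128 * B) * (128 * B / sigma t ^ 2 * c) := by field_simp
    _ ≤ _ := by gcongr; linarith

/-- Empirical risk minimization over a class `φ` with a finite uniform net `T`: with high
probability no parameter in `K` whose empirical loss is at most that of `a₀` is far from the score,
provided `a₀` is close to the score. -/
theorem measure_pi_exists_bad_le (ht : 0 < t) {m₂ : ℝ}
    (hm₂ : ∫⁻ y, ‖y‖ₑ ^ 2 ∂q₀ = ENNReal.ofReal (m₂ ^ 2)) {α : Type*} {φ : α → Vec d → Vec d}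
    (hφ : ∀ a, Measurable (φ a)) {K : Set α} {T : Finset α} {a₀ : α}
    {ε δs δD B r L : ℝ} (hε : 0 < ε) (hε1 : ε ≤ 1) (hδs : 0 < δs) (hδs1 : δs ≤ 1)
    (hδD : 0 < δD) (hδD1 : δD ≤ 1) {m : ℕ} (hm : 0 < m) (hB : 1 ≤ B)
    (hBm : m * Real.exp (d - B) ≤ δD / 10) (hr : 0 < r) (hrm : m * (m₂ ^ 2 / r ^ 2) ≤ δD / 10)
    (hcover : ∀ a ∈ K, ∃ b ∈ T, ∀ x, ‖x‖ ≤ r + 2 * Real.sqrt B →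
      ‖φ a x - φ b x‖ ≤ δs * ε ^ 2 / (2048 * B * sigma t))
    (ha₀ : ∫⁻ x, ‖φ a₀ x - score q₀ t x‖ₑ ^ 2 ∂(smoothed q₀ t) ≤
      ENNReal.ofReal (δs * δD * ε ^ 2 / (7680 * sigma t ^ 2)))
    (hT : (T.card : ℝ) ≤ Real.exp L) (hL : 0 ≤ L)
    (hlarge : 65536 * B * (L + Real.log (10 / δD)) ≤ m * δs * ε ^ 2) :
    (Measure.pi fun _ : Fin m => sampleLaw q₀ t) {ω | ∃ a ∈ K,
      empiricalLoss t ω (φ a) ≤ empiricalLoss t ω (φ a₀) ∧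
      ENNReal.ofReal δs < smoothed q₀ t {x | ε / sigma t < ‖φ a x - score q₀ t x‖}} ≤
      ENNReal.ofReal δD := by
  have hσ := sigma_pos ht
  have hm' : (0 : ℝ) < m := Nat.cast_pos.2 hm
  have hs := measurable_score q₀ (t := t)
  -- the threshold separating the excess loss of `a₀` from that of net points far from the score
  set τ := m * δs * ε ^ 2 / (256 * sigma t ^ 2) with hτ
  have hτ0 : 0 < τ := by positivity
  set c := Real.log (10 / δD) with hc
  have hc1 : 1 ≤ c := by
    rw [hc, Real.le_log_iff_exp_le (by positivity), le_div_iff₀ hδD]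
    nlinarith [Real.exp_one_lt_d9, Real.exp_pos 1]
  have hexpc : Real.exp (-c) = δD / 10 := by
    rw [Real.exp_neg, hc, Real.exp_log (by positivity), inv_div]
  set Q := m * δs * ε ^ 2 with hQ
  have hQB : 65536 ≤ Q := by nlinarith
  have hmδ : 2 ≤ 5 * (m * δs) := by
    have : Q ≤ m * δs := by
      rw [hQ]; exact mul_le_of_le_one_right (by positivity) (pow_le_one₀ hε.le hε1)
    linarith
  -- the exceptional events, each of probability at most `δD / 10`: bad or large samples,
  -- large excess loss of `a₀`, and small excess loss at a net point far from the score
  let E1 : Set (Fin m → Vec d × Vec d) := {ω | ∃ i, ω i ∈ (goodSamples q₀ t B)ᶜ}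
  let E2 : Set (Fin m → Vec d × Vec d) :=
    {ω | ∃ i, ω i ∈ {p : Vec d × Vec d | p.2 ∈ {z : Vec d | 4 * sigma t ^ 2 * B < ‖z‖ ^ 2}}}
  let E3 : Set (Fin m → Vec d × Vec d) :=
    {ω | ∃ i, ω i ∈ {p : Vec d × Vec d | p.1 ∈ {y : Vec d | r < ‖y‖}}}
  let E4 : Set (Fin m → Vec d × Vec d) := {ω | τ / 3 < ∑ i,
      ‖φ a₀ (noised t (ω i).1 (ω i).2) - score q₀ t (noised t (ω i).1 (ω i).2)‖ ^ 2}
  let E5 : Set (Fin m → Vec d × Vec d) := {ω | (∀ i, ω i ∈ goodSamples q₀ t B) ∧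
      128 * B / sigma t ^ 2 * c + 3 / 2 * ∑ i,
        ‖φ a₀ (noised t (ω i).1 (ω i).2) - score q₀ t (noised t (ω i).1 (ω i).2)‖ ^ 2 ≤
        ∑ i, excessLoss q₀ t (φ a₀) (ω i)}
  classical
  let T' := T.filter fun b => ENNReal.ofReal (δs / 2) ≤
      smoothed q₀ t {x | ε / (2 * sigma t) < ‖φ b x - score q₀ t x‖}
  let E6 : Set (Fin m → Vec d × Vec d) := ⋃ b ∈ T', {ω | (∀ i, ω i ∈ goodSamples q₀ t B) ∧
      ∑ i, excessLoss q₀ t (φ b) (ω i) ≤ 4 * τ}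
  set μ := Measure.pi fun _ : Fin m => sampleLaw q₀ t with hμ
  have h1 : μ E1 ≤ ENNReal.ofReal (δD / 10) := measure_pi_exists_notMem_goodSamples_le ht m hBm
  have h2 : μ E2 ≤ ENNReal.ofReal (δD / 10) := measure_pi_exists_snd_gt_le ht m hBm
  have h3 : μ E3 ≤ ENNReal.ofReal (δD / 10) := measure_pi_exists_fst_gt_le m hm₂ hr hrm
  have h4 : μ E4 ≤ ENNReal.ofReal (δD / 10) := by
    refine (measure_pi_sum_sq_gt_le m (hφ a₀) (by positivity) ha₀).trans_eq ?_
    congr 1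
    rw [hτ, hQ]
    field_simp
    norm_num
  have h5 : μ E5 ≤ ENNReal.ofReal (δD / 10) := by
    rw [← hexpc]; exact measure_pi_excessLoss_ge_le ht m hB (hφ a₀) c
  have h6 : μ E6 ≤ ENNReal.ofReal (δD / 10) := by
    refine (measure_biUnion_finset_le _ _).trans ?_
    refine (Finset.sum_le_sum fun b hb => measure_pi_excessLoss_le_le ht m hB (hφ b) hε hε1 hδs
      (Finset.mem_filter.1 hb).2).trans ?_
    rw [Finset.sum_const, nsmul_eq_mul, ← ENNReal.ofReal_natCast,
      ← ENNReal.ofReal_mul (Nat.cast_nonneg _)]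
    refine ENNReal.ofReal_le_ofReal ?_
    have hcard : (T'.card : ℝ) ≤ Real.exp L :=
      (Nat.cast_le.2 (Finset.card_filter_le _ _)).trans hT
    have hexp : L + c ≤ Q / (8192 * B) := by
      rw [le_div_iff₀ (by positivity)]; nlinarith
    calc _ ≤ Real.exp L * Real.exp (-(Q / (8192 * B))) := by gcongr
      _ = Real.exp (L - Q / (8192 * B)) := by rw [← Real.exp_add]; rfl
      _ ≤ Real.exp (-c) := Real.exp_le_exp.2 (by linarith)
      _ = _ := hexpc
  have htail : smoothed q₀ t {x | r + 2 * Real.sqrt B < ‖x‖} ≤ ENNReal.ofReal (δs / 2) := by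
    refine (smoothed_norm_gt_le ht hm₂ hr (by linarith) (δ₁ := δD / 10 / m) (δ₂ := δD / 10 / m)
      ?_ ?_).trans (ENNReal.ofReal_le_ofReal ?_)
    · rw [le_div_iff₀ hm']; linarith
    · rw [le_div_iff₀ hm']; linarith
    · rw [← add_div, div_le_iff₀ hm']; nlinarith
  have hsub : {ω : Fin m → Vec d × Vec d | ∃ a ∈ K,
      empiricalLoss t ω (φ a) ≤ empiricalLoss t ω (φ a₀) ∧
      ENNReal.ofReal δs < smoothed q₀ t {x | ε / sigma t < ‖φ a x - score q₀ t x‖}} ⊆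
      E1 ∪ E2 ∪ E3 ∪ E4 ∪ E5 ∪ E6 := by
    rintro ω ⟨a, haK, hmin, hbad⟩
    by_contra hcon
    simp only [Set.mem_union, not_or] at hcon
    obtain ⟨⟨⟨⟨⟨n1, n2⟩, n3⟩, n4⟩, n5⟩, n6⟩ := hcon
    have g1 : ∀ i, ω i ∈ goodSamples q₀ t B := fun i => by
      by_contra h; exact n1 ⟨i, h⟩
    have g2 : ∀ i, ‖(ω i).2‖ ^ 2 ≤ 4 * sigma t ^ 2 * B := fun i => by
      by_contra h; exact n2 ⟨i, not_le.1 h⟩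
    have g3 : ∀ i, ‖(ω i).1‖ ≤ r := fun i => by
      by_contra h; exact n3 ⟨i, not_le.1 h⟩
    have g4 : ∑ i, ‖φ a₀ (noised t (ω i).1 (ω i).2) - score q₀ t (noised t (ω i).1 (ω i).2)‖ ^ 2 ≤
      τ / 3 := not_lt.1 n4
    have g5 : ∑ i, excessLoss q₀ t (φ a₀) (ω i) ≤ τ := by
      have h := not_le.1 fun h => n5 ⟨g1, h⟩
      have h7 : 128 * B / sigma t ^ 2 * c ≤ τ / 2 := by
        rw [hτ, div_mul_eq_mul_div, div_div, div_le_div_iff₀ (by positivity) (by positivity)]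
        nlinarith [mul_nonneg (mul_nonneg (by linarith : 0 ≤ B) hL) (sq_nonneg (sigma t)),
          mul_le_mul_of_nonneg_right hlarge (sq_nonneg (sigma t))]
      linarith
    obtain ⟨b, hbT, hab⟩ := hcover a haK
    have hB0 : 0 < B := by linarith
    have hρ : δs * ε ^ 2 / (2048 * B * sigma t) ≤ ε / (2 * sigma t) := by
      rw [div_le_div_iff₀ (by positivity) (by positivity)]
      have : δs * ε ^ 2 ≤ ε := by nlinarith
      have h8 : δs * ε ^ 2 * (2 * sigma t) ≤ ε * (2 * sigma t) := by gcongr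
      have h9 : ε * (2 * sigma t) ≤ ε * (2048 * B * sigma t) := by
        gcongr; linarith
      linarith
    refine n6 (Set.mem_biUnion (x := b) (Finset.mem_coe.2 (Finset.mem_filter.2 ⟨hbT, ?_⟩))
      ⟨g1, ?_⟩)
    · -- the net point is still far from the score, up to the mass of large `‖x‖`
      have hsub' : {x | ε / sigma t < ‖φ a x - score q₀ t x‖} ⊆
          {x | ε / (2 * sigma t) < ‖φ b x - score q₀ t x‖} ∪
            {x | r + 2 * Real.sqrt B < ‖x‖} := by
        intro x hx
        by_contra hcon
        simp only [Set.mem_union, Set.mem_ofPred_eq, not_or, not_lt] at hcon hx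
        have h10 := norm_sub_le_norm_sub_add_norm_sub (φ a x) (φ b x) (score q₀ t x)
        have h11 := hab x hcon.2
        have h12 : ε / sigma t = ε / (2 * sigma t) + ε / (2 * sigma t) := by
          field_simp; ring
        linarith [hcon.1]
      have h13 := hbad.trans_le ((measure_mono hsub').trans (measure_union_le _ _))
      have h14 : ENNReal.ofReal δs = ENNReal.ofReal (δs / 2) + ENNReal.ofReal (δs / 2) := by
        rw [← ENNReal.ofReal_add (by positivity) (by positivity)]; congr 1; ring
      rw [h14] at h13
      by_contra hlt
      exact absurd h13 (not_lt.2 (add_le_add (not_le.1 hlt).le htail))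
    · -- this `γ` balances the two error terms: each is at most `τ`
      refine sum_excessLoss_le_of_close ht hm (γ := δs * ε ^ 2 / (4096 * B))
        (ρ := δs * ε ^ 2 / (2048 * B * sigma t)) (by positivity) ?_ g1 g2 hmin g5
        (fun i => hab _ (norm_noised_le ht hB0.le (g3 i) (g2 i))) ?_ ?_
      · rw [div_le_one (by positivity)]
        nlinarith [mul_le_one₀ hδs1 (by positivity) (pow_le_one₀ hε.le hε1 (n := 2))]
      · rw [hτ, hQ]
        refine le_of_eq ?_
        field_simp
        norm_num
      · rw [hτ, hQ]
        have : 2 * m * (δs * ε ^ 2 / (2048 * B * sigma t)) ^ 2 / (δs * ε ^ 2 / (4096 * B)) =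
            m * δs * ε ^ 2 / (512 * B * sigma t ^ 2) := by
          field_simp
          norm_num
        rw [this]
        gcongr
        linarith
  refine (measure_mono hsub).trans ?_
  have hu : ∀ A A' : Set (Fin m → Vec d × Vec d), μ (A ∪ A') ≤ μ A + μ A' := measure_union_le
  calc _ ≤ μ E1 + μ E2 + μ E3 + μ E4 + μ E5 + μ E6 := by
        refine (hu _ _).trans (add_le_add ?_ le_rfl)
        refine (hu _ _).trans (add_le_add ?_ le_rfl)
        refine (hu _ _).trans (add_le_add ?_ le_rfl)
        refine (hu _ _).trans (add_le_add ?_ le_rfl)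
        exact hu _ _
    _ ≤ ENNReal.ofReal (δD / 10) + ENNReal.ofReal (δD / 10) + ENNReal.ofReal (δD / 10) +
        ENNReal.ofReal (δD / 10) + ENNReal.ofReal (δD / 10) + ENNReal.ofReal (δD / 10) := by
        gcongr
    _ = ENNReal.ofReal (6 * (δD / 10)) := by
        have hp : 0 ≤ δD / 10 := by positivity
        repeat rw [← ENNReal.ofReal_add (by positivity) hp]
        congr 1; ring
    _ ≤ _ := ENNReal.ofReal_le_ofReal (by linarith)

end Probability

/-! ### The sample size -/

/-- A sample size above `K A log² (2 + A)` also beats `A log² m`, up to constants. -/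
lemma mul_one_add_log_sq_le {A m : ℝ} (hA : 1 / 2 ≤ A)
    (hm : 10 ^ 18 * A * Real.log (2 + A) ^ 2 < m) :
    10 ^ 17 * A ≤ m ∧ 6 * 10 ^ 6 * A * (1 + Real.log m) ^ 2 ≤ m := by
  set a := Real.log (2 + A) with ha
  have ha0 : 0.69 ≤ a := by
    have h1 : Real.log 2 ≤ a := Real.log_le_log (by norm_num) (by linarith)
    linarith [Real.log_two_gt_d9]
  have ha2 : 0.47 ≤ a ^ 2 := by nlinarith
  have h1 : 10 ^ 17 * A ≤ m := by nlinarith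
  have hm1 : 5 * 10 ^ 16 ≤ m := by linarith
  have hm0 : 0 < m := by linarith
  refine ⟨h1, ?_⟩
  have hlog0 : 0 ≤ Real.log m := Real.log_nonneg (by linarith)
  rcases le_or_gt (Real.log m) (6 * a) with h | h
  · have h2 : 1 + Real.log m ≤ 7.5 * a := by linarith
    have h3 : (1 + Real.log m) ^ 2 ≤ (7.5 * a) ^ 2 := by gcongr
    have h4 : A * (1 + Real.log m) ^ 2 ≤ A * (7.5 * a) ^ 2 := by gcongr
    have h5 : 0 ≤ A * a ^ 2 := by positivity
    nlinarith
  · -- here `2 + A` is below the sixth root `s` of `m`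
    set s := Real.exp (Real.log m / 6) with hs
    have hs6 : s ^ 6 = m := by
      rw [hs, ← Real.exp_nat_mul]
      norm_num
      rw [mul_div_cancel₀ _ (by norm_num : (6 : ℝ) ≠ 0), Real.exp_log hm0]
    have hAs : A ≤ s := by
      have h2 : Real.exp a ≤ s := Real.exp_le_exp.2 (by linarith)
      rw [ha, Real.exp_log (by linarith)] at h2
      linarith
    have hs0 : 0 < s := Real.exp_pos _
    have h3 : 1 + Real.log m ≤ 6 * s := by
      have := Real.add_one_le_exp (Real.log m / 6)
      rw [← hs] at this
      linarith
    have h4 : (2.2 * 10 ^ 8 : ℝ) ≤ s ^ 3 := by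
      refine le_of_sq_le_sq ?_ (by positivity)
      rw [← pow_mul]
      norm_num
      linarith
    calc 6 * 10 ^ 6 * A * (1 + Real.log m) ^ 2 ≤ 6 * 10 ^ 6 * s * (6 * s) ^ 2 := by gcongr
      _ = 216 * 10 ^ 6 * s ^ 3 := by ring
      _ ≤ s ^ 3 * s ^ 3 := by gcongr; linarith
      _ = m := by rw [← hs6]; ring

lemma sqrt_le_self_of_one_le {x : ℝ} (hx : 1 ≤ x) : Real.sqrt x ≤ x :=
  (Real.sqrt_le_left (by linarith)).2 (le_self_pow₀ hx two_ne_zero)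

/-- The number of grid points per coordinate is at most `(m V) ^ (10 D)`, where `log V` is the
logarithmic factor in the sample complexity. Every quantity entering the grid width is bounded by a
power of `U = m V`, because `P`, `D`, `d` and `1 / e` are at most `m`. -/
lemma grid_size_le {P D : ℕ} {d m V Θ μ δD e B r : ℝ} (hP : 1 ≤ P) (hD : 1 ≤ D)
    (hm : 10 ^ 6 ≤ m) (hPm : (P : ℝ) ≤ m) (hDm : (D : ℝ) ≤ m) (hdm : d ≤ m)
    (hΘ : 1 < Θ) (hμ : 1 ≤ μ) (hδ : 0 < δD) (hδ1 : δD < 1) (hV : V = 2 * (μ * Θ) / δD)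
    (he : 0 < e) (hem : 1 / e ≤ m) (hB : B = d + Real.log (10 * m / δD)) (hB1 : 1 ≤ B)
    (hr : r = μ * Real.sqrt (10 * m / δD)) :
    ⌈2 * Θ * ((P * Θ + 1) ^ D * (D * (1 + (r + 2 * Real.sqrt B)))) * (2048 * B / e)⌉₊ + 1 ≤
      ((m * V) ^ (10 * D) : ℝ) := by
  have hP' : (1 : ℝ) ≤ P := by exact_mod_cast hP
  have hD' : (1 : ℝ) ≤ D := by exact_mod_cast hD
  have hm0 : 0 < m := by linarith
  have hVδ : V * δD = 2 * (μ * Θ) := by rw [hV]; field_simp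
  have hV0 : 0 < V := by rw [hV]; positivity
  have hV1 : 2 * (μ * Θ) ≤ V := by rw [← hVδ]; exact mul_le_of_le_one_right hV0.le hδ1.le
  have hΘμ : Θ ≤ μ * Θ := le_mul_of_one_le_left (by linarith) hμ
  have hμΘ : μ ≤ μ * Θ := le_mul_of_one_le_right (by linarith) hΘ.le
  have hVΘ : 2 * Θ ≤ V := by linarith
  have hVμ : μ ≤ V := by linarith
  have hV2 : 2 ≤ V := by linarith
  have hVd : 1 / δD ≤ V := by
    rw [div_le_iff₀ hδ, hVδ]; linarith
  set U := m * V with hU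
  have hUm : m ≤ U := le_mul_of_one_le_right hm0.le (by linarith)
  have hUV : V ≤ U := le_mul_of_one_le_left hV0.le (by linarith)
  have hU6 : 10 ^ 6 ≤ U := by linarith
  have hU0 : 0 < U := by linarith
  have hw : 10 * m / δD ≤ 10 * U := by
    calc 10 * m / δD = 10 * m * (1 / δD) := by ring
      _ ≤ 10 * m * V := by gcongr
      _ = _ := by rw [hU]; ring
  have hw1 : 1 ≤ 10 * m / δD := by
    rw [le_div_iff₀ hδ]; linarith
  have hrU : r ≤ 10 * U ^ 2 := by
    have h1 : Real.sqrt (10 * m / δD) ≤ 10 * m / δD :=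
      sqrt_le_self_of_one_le hw1
    calc r ≤ U * (10 * U) := by
          rw [hr]
          exact mul_le_mul (hVμ.trans hUV) (h1.trans hw) (Real.sqrt_nonneg _) hU0.le
      _ = _ := by ring
  have hr0 : 0 ≤ r := by rw [hr]; positivity
  have hBU : B ≤ 11 * U := by
    have h1 : Real.log (10 * m / δD) ≤ 10 * m / δD := Real.log_le_self (by positivity)
    rw [hB]; linarith
  have hsB : Real.sqrt B ≤ B := sqrt_le_self_of_one_le hB1
  have hR : 1 + (r + 2 * Real.sqrt B) ≤ U ^ 3 := by
    have h1 : (10 : ℝ) ^ 6 * U ^ 2 ≤ U ^ 3 := by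
      rw [pow_succ U 2, mul_comm]; gcongr
    have h2 : U ≤ U ^ 2 := le_self_pow₀ (by linarith) two_ne_zero
    linarith
  have hM : P * Θ + 1 ≤ U := by
    have h1 : 1 ≤ P * Θ := one_le_mul_of_one_le_of_one_le hP' hΘ.le
    calc P * Θ + 1 ≤ P * (2 * Θ) := by linarith
      _ ≤ m * V := by gcongr
  have hBe : 2048 * B / e ≤ U ^ 3 := by
    calc 2048 * B / e = 2048 * B * (1 / e) := by ring
      _ ≤ U ^ 2 * U := by
        refine mul_le_mul ?_ (hem.trans hUm) (by positivity) (by positivity)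
        have h1 : (10 : ℝ) ^ 6 * U ≤ U ^ 2 := by rw [pow_two]; gcongr
        linarith
      _ = _ := by ring
  have hX : 2 * Θ * ((P * Θ + 1) ^ D * (D * (1 + (r + 2 * Real.sqrt B)))) * (2048 * B / e) ≤
      U ^ (D + 8) := by
    have hB0 : 0 ≤ 2048 * B / e := by positivity
    have hMD : (P * Θ + 1) ^ D ≤ U ^ D := by gcongr
    calc _ ≤ U * (U ^ D * (U * U ^ 3)) * U ^ 3 := by
          gcongr
          · linarith
          · linarith
      _ = _ := by ring
  have hX0 : 0 ≤ 2 * Θ * ((P * Θ + 1) ^ D * (D * (1 + (r + 2 * Real.sqrt B)))) *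
      (2048 * B / e) := by positivity
  have hceil := (Nat.ceil_lt_add_one hX0).le
  have h8 : 1 ≤ U ^ (D + 8) := one_le_pow₀ (by linarith)
  calc _ ≤ U ^ (D + 8) + 1 + 1 := by linarith
    _ ≤ 3 * U ^ (D + 8) := by linarith
    _ ≤ U * U ^ (D + 8) := by gcongr; linarith
    _ = U ^ (D + 9) := by ring
    _ ≤ U ^ (10 * D) := pow_le_pow_right₀ (by linarith) (by omega)

/-- The sample size is large compared with `B` times the logarithm of the size of the parameter
grid, where `n + 1` is the number of grid points per coordinate. -/
lemma sample_size_le {d P D : ℕ} {m₂ Θ ε δs δD m n : ℝ} (hd : 1 ≤ d) (hP : 1 ≤ P) (hD : 1 ≤ D)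
    (hΘ : 1 < Θ) (hε : 0 < ε) (hε1 : ε ≤ 1) (hδs : 0 < δs) (hδs1 : δs < 1) (hδ : 0 < δD)
    (hδ1 : δD < 1)
    (hm : 10 ^ 18 * leadingTerm d P D m₂ Θ ε δs δD *
      Real.log (2 + leadingTerm d P D m₂ Θ ε δs δD) ^ 2 < m)
    (hn0 : 0 ≤ n)
    (hn : 10 ^ 6 ≤ m → (P : ℝ) ≤ m → (D : ℝ) ≤ m → (d : ℝ) ≤ m → 1 / (δs * ε ^ 2) ≤ m →
      n + 1 ≤ (m * (2 * (max m₂ 1 * Θ) / δD)) ^ (10 * D)) :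
    1 ≤ m ∧ 65536 * (d + Real.log (10 * m / δD)) * (P * Real.log (n + 1) + Real.log (10 / δD)) ≤
      m * δs * ε ^ 2 := by
  have hd' : (1 : ℝ) ≤ d := by exact_mod_cast hd
  have hP' : (1 : ℝ) ≤ P := by exact_mod_cast hP
  have hD' : (1 : ℝ) ≤ D := by exact_mod_cast hD
  set μ := max m₂ 1 with hμ_def
  have hμ : 1 ≤ μ := le_max_right _ _
  set V := 2 * (μ * Θ) / δD with hV
  have hVδ : V * δD = 2 * (μ * Θ) := by rw [hV]; field_simp
  have hV0 : 0 < V := by positivity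
  have hV1 : 2 * (μ * Θ) ≤ V := by rw [← hVδ]; exact mul_le_of_le_one_right hV0.le hδ1.le
  have hΘμ : Θ ≤ μ * Θ := le_mul_of_one_le_left (by linarith) hμ
  have hV2 : 2 ≤ V := by linarith
  have hVd : 1 / δD ≤ V := by
    rw [div_le_iff₀ hδ, hVδ]; linarith
  set Λ := Real.log V with hΛ
  have hΛ0 : 0.69 ≤ Λ := by
    have h1 : Real.log 2 ≤ Λ := Real.log_le_log (by norm_num) hV2
    linarith [Real.log_two_gt_d9]
  set G := (d : ℝ) + Real.log (1 / δD) with hG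
  have hlogδ : 0 ≤ Real.log (1 / δD) := Real.log_nonneg (by rw [le_div_iff₀ hδ]; linarith)
  have hGd : d ≤ G := by linarith
  set e := δs * ε ^ 2 with he
  have he0 : 0 < e := by positivity
  have he1 : e ≤ 1 := mul_le_one₀ hδs1.le (by positivity) (pow_le_one₀ hε.le hε1)
  set A := leadingTerm d P D m₂ Θ ε δs δD with hA
  have hAe : A * e = G * (P * D) * Λ := by
    rw [hA, leadingTerm, ← hμ_def, ← hG, ← hV, ← hΛ, he, mul_comm (ε ^ 2) δs]
    field_simp
  have hG1 : 1 ≤ G := by linarith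
  have hPD : (1 : ℝ) ≤ P * D := one_le_mul_of_one_le_of_one_le hP' hD'
  have hGPD : 1 ≤ G * (P * D) := one_le_mul_of_one_le_of_one_le hG1 hPD
  have hAe0 : G * (P * D) * 0.69 ≤ A * e := by rw [hAe]; gcongr
  have hAe1 : 0.69 ≤ A * e := by linarith
  have hA0 : 0 < A := pos_of_mul_pos_left (by linarith) he0.le
  have hAeA : A * e ≤ A := mul_le_of_le_one_right hA0.le he1
  obtain ⟨hmA, hmain⟩ := mul_one_add_log_sq_le (by linarith) hm
  have hbig : ∀ v : ℝ, v ≤ G * (P * D) → v ≤ m := fun v hv => by linarith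
  have hm6 : 10 ^ 6 ≤ m := by linarith
  have hm1 : 1 ≤ m := by linarith
  have hm0 : 0 < m := by linarith
  refine ⟨hm1, ?_⟩
  have hPP : (P : ℝ) ≤ P * D := le_mul_of_one_le_right (by linarith) hD'
  have hDP : (D : ℝ) ≤ P * D := le_mul_of_one_le_left (by linarith) hP'
  have hPG : (P : ℝ) * D ≤ G * (P * D) := le_mul_of_one_le_left (by linarith) hG1
  have hGG : G ≤ G * (P * D) := le_mul_of_one_le_right (by linarith) hPD
  have hem : 1 / e ≤ m := by
    rw [div_le_iff₀ he0]
    have : 10 ^ 17 * A * e ≤ m * e := by gcongr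
    linarith
  have hnU := hn hm6 (hbig _ (by linarith)) (hbig _ (by linarith)) (hbig _ (by linarith)) hem
  have hlm : 0 ≤ Real.log m := Real.log_nonneg hm1
  set ℓ := 1 + Real.log m with hℓ
  have hℓ1 : 1 ≤ ℓ := by linarith
  have hlog10 : Real.log 10 ≤ 3 := by
    have h1 : Real.log 10 ≤ Real.log 16 := Real.log_le_log (by norm_num) (by norm_num)
    have h2 : Real.log 16 = 4 * Real.log 2 := by
      rw [show (16 : ℝ) = 2 ^ 4 by norm_num, Real.log_pow]; norm_num
    linarith [Real.log_two_lt_d9]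
  have hB : d + Real.log (10 * m / δD) ≤ 4 * G * ℓ := by
    have h1 : Real.log (10 * m / δD) = Real.log 10 + Real.log m + Real.log (1 / δD) := by
      rw [div_eq_mul_one_div, Real.log_mul (by positivity) (by positivity),
        Real.log_mul (by norm_num) (by positivity)]
    rw [h1]
    have h2 : G ≤ G * ℓ := le_mul_of_one_le_right (by linarith) hℓ1
    have h3 : ℓ ≤ G * ℓ := le_mul_of_one_le_left (by linarith) hG1
    linarith
  have hB0 : 0 ≤ d + Real.log (10 * m / δD) := by
    have : 0 ≤ Real.log (10 * m / δD) := Real.log_nonneg (by rw [le_div_iff₀ hδ]; linarith)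
    linarith
  have hL : Real.log (n + 1) ≤ 15 * D * Λ * ℓ := by
    have h1 : Real.log (n + 1) ≤ 10 * D * (Real.log m + Λ) := by
      refine (Real.log_le_log (by linarith) hnU).trans_eq ?_
      rw [Real.log_pow, Real.log_mul (by positivity) (by positivity)]
      push_cast
      ring
    have h2 : Real.log m + Λ ≤ 1.5 * (Λ * ℓ) := by
      have h3 : 0.69 * Real.log m ≤ Λ * Real.log m := by gcongr
      have h4 : Λ * ℓ = Λ + Λ * Real.log m := by rw [hℓ]; ring
      linarith
    calc _ ≤ 10 * D * (Real.log m + Λ) := h1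
      _ ≤ 10 * D * (1.5 * (Λ * ℓ)) := by gcongr
      _ = _ := by ring
  have hδlog : Real.log (10 / δD) ≤ 6 * Λ := by
    have h1 : Real.log (10 / δD) = Real.log 10 + Real.log (1 / δD) := by
      rw [div_eq_mul_one_div, Real.log_mul (by norm_num) (by positivity)]
    have h2 : Real.log (1 / δD) ≤ Λ := Real.log_le_log (by positivity) hVd
    linarith
  have hδlog0 : 0 ≤ Real.log (10 / δD) := Real.log_nonneg (by rw [le_div_iff₀ hδ]; linarith)
  have hLn : 0 ≤ Real.log (n + 1) := Real.log_nonneg (by linarith)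
  have hΛpos : 0 < Λ := by linarith
  have hsum : P * Real.log (n + 1) + Real.log (10 / δD) ≤ 21 * (P * D) * Λ * ℓ := by
    have h1 : P * Real.log (n + 1) ≤ P * (15 * D * Λ * ℓ) := by gcongr
    have h2 : 6 * Λ ≤ 6 * ((P * D) * (Λ * ℓ)) := by
      have h3 : Λ ≤ Λ * ℓ := le_mul_of_one_le_right hΛpos.le hℓ1
      have h4 : Λ * ℓ ≤ (P * D) * (Λ * ℓ) := le_mul_of_one_le_left (by positivity) hPD
      linarith
    linarith
  have hG0 : 0 < G := by linarith
  calc _ ≤ 65536 * (4 * G * ℓ) * (21 * (P * D) * Λ * ℓ) := by gcongr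
    _ = 5505024 * (G * (P * D) * Λ) * ℓ ^ 2 := by ring
    _ = 5505024 * A * ℓ ^ 2 * e := by rw [← hAe]; ring
    _ ≤ m * e := by
      gcongr
      refine le_trans ?_ hmain
      gcongr
      norm_num
    _ = _ := by rw [he]; ring

/-! ### Empirical minimizers over ReLU networks -/

lemma quantileError_le_ofReal_iff {d : ℕ} (p : Measure (Vec d)) (δ : ℝ) (f g : Vec d → Vec d)
    {r : ℝ} (hr : 0 ≤ r) : quantileError p δ f g ≤ ENNReal.ofReal r ↔
      p {x | r < ‖f x - g x‖} ≤ ENNReal.ofReal δ := by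
  rw [quantileError_le_iff]
  simp_rw [← ofReal_norm, ENNReal.ofReal_lt_ofReal_iff_of_nonneg hr]

/-- Chebyshev's inequality: a small mean squared distance to the score bounds the quantile
error. -/
lemma quantileError_le_of_lintegral_le {d : ℕ} {q₀ : Measure (Vec d)} {t : ℝ}
    {f : Vec d → Vec d} (hf : Measurable f) {r δ : ℝ} (hr : 0 < r)
    (h : ∫⁻ x, ‖f x - score q₀ t x‖ₑ ^ 2 ∂(smoothed q₀ t) ≤ ENNReal.ofReal (δ * r ^ 2)) :
    quantileError (smoothed q₀ t) δ f (score q₀ t) ≤ ENNReal.ofReal r := by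
  have hs := measurable_score q₀ (t := t)
  rw [quantileError_le_ofReal_iff _ _ _ _ hr.le]
  have hsub : {x | r < ‖f x - score q₀ t x‖} ⊆
      {x | ENNReal.ofReal (r ^ 2) ≤ ‖f x - score q₀ t x‖ₑ ^ 2} := fun x hx => by
    simp only [Set.mem_ofPred_eq] at hx ⊢
    rw [← ofReal_norm, ← ENNReal.ofReal_pow (norm_nonneg _)]
    exact ENNReal.ofReal_le_ofReal (by gcongr)
  refine (measure_mono hsub).trans ((meas_ge_le_lintegral_div (by fun_prop)
    (by simp; positivity) ENNReal.ofReal_ne_top).trans ?_)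
  calc _ ≤ ENNReal.ofReal (δ * r ^ 2) / ENNReal.ofReal (r ^ 2) := by gcongr
    _ = ENNReal.ofReal δ := by
      rw [← ENNReal.ofReal_div_of_pos (by positivity)]
      congr 1
      field_simp

/-- For a network with at least one parameter, in positive dimension: parameters with empirical loss
at most that of `θstar` are far from the score only with probability `δD`. -/
theorem measure_pi_exists_minimizer_bad_le {d : ℕ} (hd : 1 ≤ d) {q₀ : Measure (Vec d)}
    [IsProbabilityMeasure q₀] {m₂ : ℝ} (hm₂0 : 0 ≤ m₂)
    (hm₂ : ∫⁻ y, ‖y‖ₑ ^ 2 ∂q₀ = ENNReal.ofReal (m₂ ^ 2)) {t : ℝ} (ht : 0 < t) (bias : Bool)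
    (hidden : List ℕ) (hP : 1 ≤ numParams bias d hidden d) {Θ ε δs δD : ℝ} (hΘ : 1 < Θ)
    (hε : 0 < ε) (hε1 : ε ≤ 1) (hδs : 0 < δs) (hδs1 : δs < 1) (hδ : 0 < δD) (hδ1 : δD < 1)
    {θstar : ParamIdx bias d hidden d → ℝ}
    (hθstar : ∫⁻ x, ‖network bias d hidden d θstar x - score q₀ t x‖ₑ ^ 2 ∂(smoothed q₀ t) ≤
      ENNReal.ofReal (δs * δD * ε ^ 2 / (7680 * sigma t ^ 2))) {m : ℕ}
    (hm : 10 ^ 18 * leadingTerm d (numParams bias d hidden d) (depth hidden) m₂ Θ ε δs δD *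
      Real.log (2 + leadingTerm d (numParams bias d hidden d) (depth hidden) m₂ Θ ε δs δD) ^ 2
      < (m : ℝ)) :
    (Measure.pi fun _ : Fin m => sampleLaw q₀ t)
      {ω | ∃ θ ∈ {θ : ParamIdx bias d hidden d → ℝ | ‖θ‖ ≤ Θ},
        empiricalLoss t ω (network bias d hidden d θ) ≤
          empiricalLoss t ω (network bias d hidden d θstar) ∧
        ENNReal.ofReal δs < smoothed q₀ t
          {x | ε / sigma t < ‖network bias d hidden d θ x - score q₀ t x‖}} ≤
      ENNReal.ofReal δD := by
  have hσ := sigma_pos ht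
  set P := numParams bias d hidden d with hP_def
  set D := depth hidden with hD_def
  have hD : 1 ≤ D := by rw [hD_def, depth]; omega
  set B := (d : ℝ) + Real.log (10 * m / δD) with hB
  set r := max m₂ 1 * Real.sqrt (10 * m / δD) with hr
  -- the number of grid points per coordinate
  set n := ⌈2 * Θ * ((P * Θ + 1) ^ D * (D * (1 + (r + 2 * Real.sqrt B)))) *
    (2048 * B / (δs * ε ^ 2))⌉₊ with hn
  have hd' : (1 : ℝ) ≤ d := by exact_mod_cast hd
  have hB1_of : 1 ≤ (m : ℝ) → 1 ≤ B := fun hm1 => by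
    have : 0 ≤ Real.log (10 * m / δD) := Real.log_nonneg (by rw [le_div_iff₀ hδ]; linarith)
    linarith
  obtain ⟨hm1, hlarge⟩ := sample_size_le hd hP hD hΘ hε hε1 hδs hδs1 hδ hδ1 hm
    (Nat.cast_nonneg n) fun h1 h2 h3 h4 h5 => by
      exact grid_size_le hP hD h1 h2 h3 h4 hΘ (le_max_right _ _) hδ hδ1 rfl (by positivity) h5 hB
        (hB1_of (by linarith)) hr
  have hB1 := hB1_of hm1
  have hm0 : (0 : ℝ) < m := by linarith
  have hμ : 0 < max m₂ 1 := lt_of_lt_of_le one_pos (le_max_right _ _)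
  have hr0 : 0 < r := by rw [hr]; positivity
  have hP0 : (0 : ℝ) < P := Nat.cast_pos.2 hP
  have hD0 : (0 : ℝ) < D := Nat.cast_pos.2 hD
  have hΘ0 : 0 < Θ := by linarith
  have hX0 : 0 < 2 * Θ * ((P * Θ + 1) ^ D * (D * (1 + (r + 2 * Real.sqrt B)))) *
    (2048 * B / (δs * ε ^ 2)) := by positivity
  have hn0 : 0 < n := Nat.ceil_pos.2 hX0
  have hn0' : (0 : ℝ) < n := Nat.cast_pos.2 hn0
  obtain ⟨T, hTcard, hTnorm, hTcover⟩ := exists_finset_net (ParamIdx bias d hidden d) hΘ0 hn0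
  refine measure_pi_exists_bad_le ht hm₂ (T := T) (r := r) (B := B) (L := P * Real.log (n + 1))
    (fun θ => measurable_network bias d hidden d θ) hε hε1 hδs hδs1.le hδ hδ1.le
    (Nat.cast_pos.1 hm0) hB1 ?_ hr0 ?_ ?_ hθstar ?_ ?_ hlarge
  · rw [hB, sub_add_cancel_left, Real.exp_neg, Real.exp_log (by positivity)]
    refine le_of_eq ?_
    field_simp
  · rw [hr, mul_pow, Real.sq_sqrt (by positivity)]
    have h1 : m₂ ^ 2 ≤ max m₂ 1 ^ 2 := by gcongr; exact le_max_left _ _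
    calc m * (m₂ ^ 2 / (max m₂ 1 ^ 2 * (10 * m / δD))) ≤
        m * (max m₂ 1 ^ 2 / (max m₂ 1 ^ 2 * (10 * m / δD))) := by gcongr
      _ = δD / 10 := by field_simp
  · intro θ hθ
    obtain ⟨θ', hθ'T, hθθ'⟩ := hTcover θ hθ
    refine ⟨θ', hθ'T, fun x hx => ?_⟩
    have h1 := norm_network_sub_le bias d (M := P * Θ + 1) hΘ.le hidden d θ θ' x x hθ
      (hTnorm θ' hθ'T) hθθ' le_rfl
    rw [sub_self, norm_zero, add_zero] at h1
    have hXn : 2 * Θ * ((P * Θ + 1) ^ D * (D * (1 + (r + 2 * Real.sqrt B)))) *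
      (2048 * B / (δs * ε ^ 2)) ≤ n := Nat.le_ceil _
    have hσ1 := sigma_le_one ht
    calc _ ≤ (P * Θ + 1) ^ D * (D * (2 * Θ / n) * (1 + ‖x‖)) := h1
      _ ≤ (P * Θ + 1) ^ D * (D * (2 * Θ / n) * (1 + (r + 2 * Real.sqrt B))) := by gcongr
      _ = 2 * Θ * ((P * Θ + 1) ^ D * (D * (1 + (r + 2 * Real.sqrt B)))) *
          (2048 * B / (δs * ε ^ 2)) * (δs * ε ^ 2 / (2048 * B * 1)) / n := by
        have : B ≠ 0 := by linarith
        field_simp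
      _ ≤ n * (δs * ε ^ 2 / (2048 * B * 1)) / n := by gcongr
      _ = δs * ε ^ 2 / (2048 * B * 1) := by field_simp
      _ ≤ _ := by gcongr
  · rw [Real.exp_nat_mul, Real.exp_log (by positivity)]
    exact_mod_cast hTcard
  · exact mul_nonneg hP0.le (Real.log_nonneg (by linarith))

end ScoreLearning

theorem mainTheorem1 :
    ∃ C : ℝ, 0 < C ∧ ∃ K : ℝ, 0 < K ∧ ∃ k : ℕ,
      ∀ (d : ℕ) (q₀ : Measure (ScoreLearning.Vec d)) (_ : IsProbabilityMeasure q₀)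
        (m₂ : ℝ) (_ : 0 ≤ m₂) (_ : ∫⁻ y, ‖y‖ₑ ^ 2 ∂q₀ = ENNReal.ofReal (m₂ ^ 2))
        (t : ℝ) (_ : 0 < t)
        (bias : Bool) (hidden : List ℕ)
        (P : ℕ) (_ : P = ScoreLearning.numParams bias d hidden d)
        (D : ℕ) (_ : D = ScoreLearning.depth hidden)
        (Θ ε δscore δD : ℝ) (_ : 1 < Θ) (_ : 0 < ε) (_ : ε ≤ 1)
        (_ : 0 < δscore) (_ : δscore < 1) (_ : 0 < δD) (_ : δD < 1)
        (θstar : ScoreLearning.ParamIdx bias d hidden d → ℝ) (_ : ‖θstar‖ ≤ Θ)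
        (_ : ∫⁻ x, ‖ScoreLearning.network bias d hidden d θstar x - ScoreLearning.score q₀ t x‖ₑ ^ 2
              ∂(ScoreLearning.smoothed q₀ t)
            ≤ ENNReal.ofReal (δscore * δD * ε ^ 2 / (C * ScoreLearning.sigma t ^ 2)))
        (m : ℕ)
        (_ : (m : ℝ) > K * ScoreLearning.leadingTerm d P D m₂ Θ ε δscore δD *
            Real.log (2 + ScoreLearning.leadingTerm d P D m₂ Θ ε δscore δD) ^ k),
        Measure.pi (fun _ : Fin m => ScoreLearning.sampleLaw q₀ t)
            {ω | ¬ ∀ θhat : ScoreLearning.ParamIdx bias d hidden d → ℝ,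
              ScoreLearning.IsEmpiricalMinimizer bias hidden t Θ ω θhat →
              ScoreLearning.quantileError (ScoreLearning.smoothed q₀ t) δscore
                  (ScoreLearning.network bias d hidden d θhat) (ScoreLearning.score q₀ t)
                ≤ ENNReal.ofReal (ε / ScoreLearning.sigma t)}
          ≤ ENNReal.ofReal δD := by
  refine ⟨7680, by norm_num, 10 ^ 18, by norm_num, 2, ?_⟩
  intro d q₀ _ m₂ hm₂0 hm₂ t ht bias hidden P hP D hD Θ ε δs δD hΘ hε hε1 hδs hδs1 hδ hδ1
    θstar hθΘ hθstar m hm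
  have hσ := ScoreLearning.sigma_pos ht
  -- Without parameters the leading term is zero and `m` may be any positive number. There, and in
  -- dimension zero, every network function equals that of `θstar`.
  by_cases htriv : d = 0 ∨ P = 0
  · have heq : ∀ θ : ScoreLearning.ParamIdx bias d hidden d → ℝ,
        ScoreLearning.network bias d hidden d θ = ScoreLearning.network bias d hidden d θstar := by
      intro θ
      rcases htriv with rfl | h0
      · funext x
        exact Subsingleton.elim _ _
      · rw [hP] at h0
        have := Fintype.card_eq_zero_iff.1 h0
        rw [Subsingleton.elim θ θstar]
    have hq := ScoreLearning.quantileError_le_of_lintegral_le (q₀ := q₀) (t := t) (δ := δs)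
      (r := ε / ScoreLearning.sigma t)
      (ScoreLearning.measurable_network bias d hidden d θstar) (by positivity)
      (hθstar.trans (ENNReal.ofReal_le_ofReal (by
        rw [div_pow, mul_div_assoc']
        gcongr
        · exact mul_le_of_le_one_right hδs.le hδ1.le
        · exact le_mul_of_one_le_left (by positivity) (by norm_num))))
    have hempty : {ω : Fin m → ScoreLearning.Vec d × ScoreLearning.Vec d |
        ¬ ∀ θhat : ScoreLearning.ParamIdx bias d hidden d → ℝ,
          ScoreLearning.IsEmpiricalMinimizer bias hidden t Θ ω θhat →
          ScoreLearning.quantileError (ScoreLearning.smoothed q₀ t) δs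
            (ScoreLearning.network bias d hidden d θhat) (ScoreLearning.score q₀ t)
            ≤ ENNReal.ofReal (ε / ScoreLearning.sigma t)} = ∅ := by
      refine Set.eq_empty_of_forall_notMem fun ω hω => hω fun θ _ => ?_
      rw [heq θ]
      exact hq
    rw [hempty]
    simp
  · rw [not_or] at htriv
    subst hP hD
    refine (measure_mono ?_).trans (ScoreLearning.measure_pi_exists_minimizer_bad_le
      (Nat.one_le_iff_ne_zero.2 htriv.1) hm₂0 hm₂ ht bias hidden
      (Nat.one_le_iff_ne_zero.2 htriv.2) hΘ hε hε1 hδs hδs1 hδ hδ1 hθstar hm)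
    intro ω hω
    simp only [Set.mem_ofPred_eq, not_forall] at hω
    obtain ⟨θ, ⟨hθ, hmin⟩, hbad⟩ := hω
    refine ⟨θ, hθ, hmin θstar hθΘ, ?_⟩
    rw [ScoreLearning.quantileError_le_ofReal_iff _ _ _ _ (by positivity)] at hbad
    exact not_le.1 hbad
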